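/- Consider $k$ polygons (oriented disks; polygons with one or two edges are allowed), numbered $1,\dots,k$, the $i$-th of which has $m_i\ge 1$ edges, one of them marked, where $m_1+\dots+m_k=2n$. A gluing is a division of all $2n$ edges into pairs; the two edges of each pair are glued together with opposite orientations, which yields a closed oriented surface carrying a graph with $n$ edges and $k$ faces. Its genus $g$, when the surface is connected, is given by Euler's formula $V-n+k=2-2g$, where $V$ is the number of vertices of the glued graph. For integers $g\ge 0$ let $\varepsilon_g(m_1,\dots,m_k;k)$ be the number of gluings for which the resulting surface is connected and of genus $g$, and for $n>0$ and $k\ge1$ put $$\varepsilon_g(n,k)=\sum_{\substack{m_1+\dots+m_k=2n\\ m_1,\dots,m_k\ge 1}}\varepsilon_g(m_1,\dots,m_k;k).$$ For $n=0$ put $\varepsilon_0(0,1)=1$ and $\varepsilon_g(0,k)=0$ for all other $g\ge0$, $k\ge1$. Write $\varepsilon_g(n)=\varepsilon_g(n,1)$. Then for all integers $n>0$ and $g\ge 0$ $$\varepsilon_g(n,2)=\varepsilon_{g+1}(n+1)-\sum_{h=0}^{g+1}\sum_{i=0}^{n}\varepsilon_h(i)\,\varepsilon_{g+1-h}(n-i)$$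 and $$\varepsilon_g(n,3)=\varepsilon_{g+1}(n+1,2)-2\sum_{h=0}^{g+1}\sum_{i=0}^{n}\varepsilon_h(i)\,\varepsilon_{g+1-h}(n-i,2)-(n+1)(2n+1)\,\varepsilon_{g+1}(n).$$ -/

import Mathlib

namespace PolygonGluing

/-- The edges of `k` polygons, the `i`-th of which has `m i` edges: the edge `⟨i, j⟩` is the `j`-th
edge of the `i`-th polygon, counted counterclockwise from its marked edge. Every edge is oriented
counterclockwise, and each vertex of a polygon is represented by the edge that starts at it. -/
abbrev Edge {k : ℕ} (m : Fin k → ℕ) : Type := Σ i : Fin k, Fin (m i)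

/-- The next edge, counterclockwise, on the same polygon. As vertices are represented by the edges
that start at them, `next m e` also represents the end point of the edge `e`. -/
def next {k : ℕ} (m : Fin k → ℕ) : Equiv.Perm (Edge m) :=
  Equiv.sigmaCongrRight fun i => finRotate (m i)

/-- A gluing of the polygons: a division of all their edges into pairs, given as the involution
without fixed points that exchanges the two edges of every pair. The edges of a pair are glued
together with opposite orientations. -/
structure Gluing {k : ℕ} (m : Fin k → ℕ) where
  /-- the edge that a given edge is glued to -/
  opp : Equiv.Perm (Edge m)
  opp_opp : ∀ e, opp (opp e) = e
  opp_ne : ∀ e, opp e ≠ e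

namespace Gluing

variable {k : ℕ} {m : Fin k → ℕ} (G : Gluing m)

/-- The vertices of the glued surface: the vertices of the polygons modulo the equivalence
relation generated by the gluing, which identifies the starting point of each edge `e`
with the end point of `opp e` (and so the end point of `e` with the starting point of `opp e`). -/
def Vertices : Type := Quot fun p q : Edge m => q = next m (G.opp p)

/-- The edges of the graph on the glued surface: the edges of the polygons modulo the gluing. -/
def Edges : Type := Quot fun e f : Edge m => f = G.opp e

/-- The connected components of the glued surface: the polygons modulo the equivalence relation
generated by having a pair of edges glued together. -/
def Components : Type := Quot fun i j : Fin k => ∃ e : Edge m, e.1 = i ∧ (G.opp e).1 = j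

/-- The glued surface is connected. -/
def IsConnected : Prop := Nat.card G.Components = 1

/-- The Euler characteristic of the glued surface: vertices minus edges plus faces. -/
noncomputable def eulerChar : ℤ :=
  (Nat.card G.Vertices : ℤ) - (Nat.card G.Edges : ℤ) + (k : ℤ)

/-- The result of the gluing is a connected (closed, oriented) surface of genus `g`. -/
def IsConnectedOfGenus (g : ℕ) : Prop := G.IsConnected ∧ G.eulerChar = 2 - 2 * (g : ℤ)

end Gluing

/-- `ε_g(m₁, …, m_k; k)`: the number of ways to glue `k` polygons with `m₁, …, m_k` edges into a
connected orientable surface of genus `g`. -/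
noncomputable def epsTuple (g : ℕ) {k : ℕ} (m : Fin k → ℕ) : ℕ :=
  Nat.card {G : Gluing m // G.IsConnectedOfGenus g}

/-- `ε_g(n, k)`: the number of ways to glue `k` polygons with `2n` edges in total into a connected
orientable surface of genus `g`, with the convention that `ε_0(0, 1) = 1` (the sphere with a single
vertex) and that all other numbers `ε_g(0, k)` are `0`. -/
noncomputable def eps (g n k : ℕ) : ℕ :=
  if n = 0 then (if g = 0 ∧ k = 1 then 1 else 0)
  else ∑ m ∈ (Finset.Nat.antidiagonalTuple k (2 * n)).filter (fun m => ∀ i, 1 ≤ m i), epsTuple g m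

end PolygonGluing

/-!
Both identities come from removing one edge of the glued graph: the marked edge of the first polygon,
together with the edge it is glued to.

If both edges lie on the same polygon, it is cut into an `a`-gon and a `b`-gon, and the gluing of the
other edges has the same vertices (a part without edges is a polygon with one vertex). The number of
edges goes down by one and the number of faces goes up by one. So if the surface stays connected, its
genus goes down by one, and if it falls into two components, their genera add up to the old genus.
If the two edges lie on different polygons, these are joined into one; the vertices and the genus stay
the same. With `2 * n` edges left, the second polygon has `c` edges, where `c` is one of
`1, …, 2 * n + 1`, and each of its edges may be the one that the marked edge is glued to, so that
every gluing of a `2 * n`-gon arises `1 + … + (2 * n + 1) = (n + 1) * (2 * n + 1)` times. Sorting the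
gluings of one polygon in this way gives the first identity, and those of two polygons the second one.

A gluing is encoded as a `Pairing` `τ` of the edges, and its vertices are the cycles of `σ * τ`, where
the cycles of `σ` are the polygons. Removing the pair of edges amounts to skipping two points of
`σ * τ` (`numCycles_option`, `numCycles_mul_insert`); `defect_split` and `defect_join` carry this out
for a polygon that is cut and for two polygons that are joined. The quantity `doubleGenus₁` is
`2 - χ` for the Euler characteristic `χ` of the glued surface, and so are `doubleGenus₂` and
`doubleGenus₃` for connected gluings. That the genera of the components run through the natural
numbers is Euler's formula, `exists_doubleGenus₁_eq` and `exists_doubleGenus₂_eq`, which follows by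
induction from the same removal of edges. The recursions are `count₁_add_two` and `count₂_add_two`.
-/

namespace PolygonGluing

open Equiv Finset

/-! ### Cycles of permutations -/

/-- The number of cycles of a permutation, fixed points included. -/
noncomputable def numCycles {E : Type} (π : Perm E) : ℕ := Nat.card (Quot fun p q : E => q = π p)

theorem numCycles_congr {E F : Type} (α : E ≃ F) {π : Perm E} {π' : Perm F}
    (h : ∀ x, α (π x) = π' (α x)) : numCycles π = numCycles π' :=
  Nat.card_congr <| Quot.congr α fun x y => by rw [← h, α.injective.eq_iff]

theorem numCycles_of_isEmpty {E : Type} [IsEmpty E] (π : Perm E) : numCycles π = 0 := by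
  have : IsEmpty (Quot fun p q : E => q = π p) := ⟨fun q => isEmptyElim q.out⟩
  exact Nat.card_of_isEmpty

theorem numCycles_sumCongr {E F : Type} [Finite E] [Finite F] (π : Perm E) (π' : Perm F) :
    numCycles (Equiv.sumCongr π π') = numCycles π + numCycles π' := by
  unfold numCycles
  rw [← Nat.card_sum]
  refine Nat.card_congr
    { toFun := Quot.lift (Sum.elim (fun x => Sum.inl (Quot.mk _ x)) fun y => Sum.inr (Quot.mk _ y)) ?_
      invFun := Sum.elim (Quot.lift (fun x => Quot.mk _ (Sum.inl x)) ?_)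
        (Quot.lift (fun y => Quot.mk _ (Sum.inr y)) ?_)
      left_inv := ?_
      right_inv := ?_ }
  · rintro (x | x) _ rfl
    · exact congrArg Sum.inl (Quot.sound rfl)
    · exact congrArg Sum.inr (Quot.sound rfl)
  · rintro x _ rfl
    exact Quot.sound rfl
  · rintro x _ rfl
    exact Quot.sound rfl
  · rintro ⟨x | x⟩ <;> rfl
  · rintro (x | x) <;> induction x using Quot.ind <;> rfl

theorem removeNone_mul_optionCongr (π : Perm (Option E)) (τ : Perm E) :
    removeNone (π * optionCongr τ) = removeNone π * τ := by
  ext x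
  apply Option.some_injective
  by_cases hx : ∃ y, π (some (τ x)) = some y
  · rw [removeNone_some _ (by simpa using hx), Perm.mul_apply, Perm.mul_apply,
      removeNone_some _ hx]
    simp
  · have hx' : π (some (τ x)) = none := by
      cases h : π (some (τ x)) with
      | none => rfl
      | some y => exact absurd ⟨y, h⟩ hx
    rw [removeNone_none _ (by simpa using hx'), Perm.mul_apply, Perm.mul_apply,
      removeNone_none _ hx']
    simp

/-- Skipping one point in a permutation changes the number of cycles only if the point is fixed. -/
theorem numCycles_option {E : Type} [Finite E] (π : Perm (Option E)) :
    numCycles π = numCycles (removeNone π) + if π none = none then 1 else 0 := by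
  have key : ∀ x : E, (Quot.mk (fun p q : Option E => q = π p) (some (removeNone π x))) =
      Quot.mk _ (some x) := fun x => by
    by_cases hx : ∃ y, π (some x) = some y
    · rw [removeNone_some π hx]
      exact (Quot.sound (r := fun p q : Option E => q = π p) rfl).symm
    · have hx' : π (some x) = none := by
        cases h : π (some x) with
        | none => rfl
        | some y => exact absurd ⟨y, h⟩ hx
      rw [removeNone_none π hx']
      exact (Quot.sound (r := fun p q : Option E => q = π p) rfl).symm.trans
        (Quot.sound (r := fun p q : Option E => q = π p) hx'.symm).symm
  unfold numCycles
  split_ifs with h0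
  · rw [← Finite.card_option]
    have hs : ∀ x : E, π (some x) = some (removeNone π x) := fun x => by
      refine (removeNone_some π ?_).symm
      cases h : π (some x) with
      | none => exact absurd (π.injective (h.trans h0.symm)) (by simp)
      | some y => exact ⟨y, rfl⟩
    refine Nat.card_congr
      { toFun := Quot.lift (fun x => x.map (Quot.mk _)) ?_
        invFun := fun q => q.elim (Quot.mk _ none) (Quot.lift (fun x => Quot.mk _ (some x)) ?_)
        left_inv := ?_
        right_inv := ?_ }
    · rintro (_ | x) _ rfl
      · rw [h0]
      · rw [hs]
        exact congrArg some (Quot.sound rfl)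
    · rintro x _ rfl
      exact (key x).symm
    · rintro ⟨_ | x⟩ <;> rfl
    · rintro (_ | x)
      · rfl
      · induction x using Quot.ind
        rfl
  · rw [add_zero]
    obtain ⟨z, hz⟩ := Option.ne_none_iff_exists'.1 h0
    refine Nat.card_congr
      { toFun := Quot.lift (fun x => x.elim (Quot.mk _ z) (Quot.mk _)) ?_
        invFun := Quot.lift (fun x => Quot.mk _ (some x)) ?_
        left_inv := ?_
        right_inv := ?_ }
    · rintro (_ | x) y h
      · subst h
        rw [hz]
        rfl
      · subst h
        cases h : π (some x) with
        | none =>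
          have := removeNone_none π h
          rw [hz, Option.some_inj] at this
          exact Quot.sound this.symm
        | some y =>
          have := removeNone_some π ⟨y, h⟩
          rw [h, Option.some_inj] at this
          exact Quot.sound this.symm
    · rintro x _ rfl
      exact (key x).symm
    · rintro ⟨_ | x⟩
      · exact (Quot.sound (r := fun p q : Option E => q = π p) hz.symm).symm
      · rfl
    · rintro ⟨x⟩
      rfl

/-! ### Pairings -/

/-- The divisions of a set into pairs, as involutions without fixed points. -/
abbrev Pairing (E : Type) : Type := {τ : Perm E // (∀ x, τ (τ x) = x) ∧ ∀ x, τ x ≠ x}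

namespace Pairing

/-- Relabelling the elements of a paired set. -/
def congr {E F : Type} (α : E ≃ F) : Pairing E ≃ Pairing F :=
  α.permCongr.subtypeEquiv fun τ => by
    simp only [permCongr_apply, symm_apply_apply]
    refine and_congr (α.forall_congr fun x => ?_) (α.forall_congr fun x => ?_)
    · simp
    · simp

@[simp] theorem congr_apply {E F : Type} (α : E ≃ F) (τ : Pairing E) (x : E) :
    (congr α τ).1 (α x) = α (τ.1 x) := by
  simp [congr, permCongr_apply]

end Pairing

/-- The number of pairs minus the number of vertices, for the pairing `τ` of the edges of polygons
whose boundaries are the cycles of `σ`. -/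
noncomputable def defect {E : Type} (σ : Perm E) (τ : Pairing E) : ℤ :=
  numCycles τ.1 - numCycles (σ * τ.1)

theorem defect_congr {E F : Type} (α : E ≃ F) {σ : Perm E} {σ' : Perm F}
    (h : ∀ x, α (σ x) = σ' (α x)) (τ : Pairing E) :
    defect σ' (Pairing.congr α τ) = defect σ τ := by
  unfold defect
  rw [numCycles_congr α (π := τ.1) (π' := (Pairing.congr α τ).1) (by simp),
    numCycles_congr α (π := σ * τ.1) (π' := σ' * (Pairing.congr α τ).1) (by simp [h])]

theorem defect_of_isEmpty {E : Type} [IsEmpty E] (σ : Perm E) (τ : Pairing E) :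
    defect σ τ = 0 := by
  simp [defect, numCycles_of_isEmpty]

/-! ### Inserting a pair -/

section insertPair

variable {E F : Type} [DecidableEq E]

/-- The involution that extends `τ` by exchanging the two new points. -/
def Pairing.insertAux (τ : Pairing E) : Pairing (Option (Option E)) :=
  ⟨swap none (some none) * optionCongr (optionCongr τ.1), by
    have h1 : ∀ x : E, swap none (some none) (some (some x)) = some (some x) := fun x =>
      swap_apply_of_ne_of_ne (by simp) (by simp)
    refine ⟨?_, ?_⟩
    · rintro (_ | _ | x) <;> simp [h1, τ.2.1]
    · rintro (_ | _ | x) <;> simp [h1, τ.2.2]⟩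

@[simp] theorem Pairing.insertAux_none (τ : Pairing E) : τ.insertAux.1 none = some none := by
  simp [Pairing.insertAux]

@[simp] theorem Pairing.insertAux_some_none (τ : Pairing E) :
    τ.insertAux.1 (some none) = none := by
  simp [Pairing.insertAux]

@[simp] theorem Pairing.insertAux_some_some (τ : Pairing E) (x : E) :
    τ.insertAux.1 (some (some x)) = some (some (τ.1 x)) := by
  simp [Pairing.insertAux, swap_apply_of_ne_of_ne]

/-- Adding a pair to `τ`: if `ψ` identifies `F` with `E` and two more points, these two points
become a new pair. -/
def Pairing.insert (ψ : Option (Option E) ≃ F) (τ : Pairing E) : Pairing F :=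
  Pairing.congr ψ τ.insertAux

@[simp] theorem Pairing.insert_none (ψ : Option (Option E) ≃ F) (τ : Pairing E) :
    (τ.insert ψ).1 (ψ none) = ψ (some none) := by
  simp [Pairing.insert]

@[simp] theorem Pairing.insert_some_none (ψ : Option (Option E) ≃ F) (τ : Pairing E) :
    (τ.insert ψ).1 (ψ (some none)) = ψ none := by
  simp [Pairing.insert]

@[simp] theorem Pairing.insert_some_some (ψ : Option (Option E) ≃ F) (τ : Pairing E) (x : E) :
    (τ.insert ψ).1 (ψ (some (some x))) = ψ (some (some (τ.1 x))) := by
  simp [Pairing.insert]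

theorem Pairing.insert_injective (ψ : Option (Option E) ≃ F) :
    Function.Injective (Pairing.insert ψ) := fun τ τ' h => by
  refine Subtype.ext (Equiv.ext fun x => ?_)
  have := τ.insert_some_some ψ x
  rw [h, Pairing.insert_some_some] at this
  simpa using this.symm

theorem Pairing.exists_insert (ψ : Option (Option E) ≃ F) (τ' : Pairing F)
    (h : τ'.1 (ψ none) = ψ (some none)) : ∃ τ : Pairing E, τ.insert ψ = τ' := by
  have h' : τ'.1 (ψ (some none)) = ψ none := by rw [← h, τ'.2.1]
  have hs : ∀ x : E, ∃ y, τ'.1 (ψ (some (some x))) = ψ (some (some y)) := fun x => by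
    obtain ⟨_ | _ | y, hy⟩ := ψ.surjective (τ'.1 (ψ (some (some x))))
    · rw [← h'] at hy
      simpa using τ'.1.injective hy
    · rw [← h] at hy
      simpa using τ'.1.injective hy
    · exact ⟨y, hy.symm⟩
  choose f hf using hs
  have hff : Function.Involutive f := fun x => by
    have := τ'.2.1 (ψ (some (some x)))
    rw [hf, hf] at this
    simpa using this
  refine ⟨⟨hff.toPerm f, hff, fun x hx => ?_⟩, Subtype.ext (Equiv.ext fun y => ?_)⟩
  · refine τ'.2.2 (ψ (some (some x))) ?_
    rw [hf]
    exact congrArg _ (congrArg _ (congrArg _ hx))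
  · obtain ⟨_ | _ | y, rfl⟩ := ψ.surjective y
    · rw [Pairing.insert_none, h]
    · rw [Pairing.insert_some_none, h']
    · rw [Pairing.insert_some_some, hf]
      rfl

/-- The pairings that pair `ψ none` with `ψ (some none)` are the pairings of the other points. -/
noncomputable def Pairing.insertEquiv (ψ : Option (Option E) ≃ F) :
    Pairing E ≃ {τ' : Pairing F // τ'.1 (ψ none) = ψ (some none)} :=
  Equiv.ofBijective (fun τ => ⟨τ.insert ψ, τ.insert_none ψ⟩)
    ⟨fun _ _ h => Pairing.insert_injective ψ (congrArg Subtype.val h), fun τ' =>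
      (Pairing.exists_insert ψ τ'.1 τ'.2).imp fun _ h => Subtype.ext h⟩

theorem card_insert (ψ : Option (Option E) ≃ F) (P : Pairing F → Prop) :
    Nat.card {τ' : Pairing F // τ'.1 (ψ none) = ψ (some none) ∧ P τ'} =
      Nat.card {τ : Pairing E // P (τ.insert ψ)} := by
  symm
  refine Nat.card_congr (((Pairing.insertEquiv ψ).subtypeEquiv
    (q := fun τ' => P τ'.1) fun τ => Iff.rfl).trans (Equiv.subtypeSubtypeEquivSubtypeInter _ _))

/-- The boundaries of the polygons after the edges `ψ none` and `ψ (some none)`, glued together,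
have been removed, before the two edges are skipped. -/
def cutAux (ψ : Option (Option E) ≃ F) (σ : Perm F) : Perm (Option (Option E)) :=
  ψ.symm.permCongr σ * swap none (some none)

/-- The boundaries of the polygons after the edges `ψ none` and `ψ (some none)`, glued together,
have been removed: a polygon that contains both edges is cut into two, and two polygons that
contain one of them each are joined to one. -/
def cut (ψ : Option (Option E) ≃ F) (σ : Perm F) : Perm E :=
  removeNone (removeNone (cutAux ψ σ))

theorem numCycles_insert [Finite E] (ψ : Option (Option E) ≃ F) (τ : Pairing E) :
    numCycles (τ.insert ψ).1 = numCycles τ.1 + 1 := by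
  have h1 : numCycles (τ.insert ψ).1 = numCycles τ.insertAux.1 :=
    (numCycles_congr ψ fun x => by simp [Pairing.insert]).symm
  have h2 : (τ.insertAux).1 = swap none (some none) * optionCongr (optionCongr τ.1) := rfl
  have h3 : removeNone (swap none (some none) : Perm (Option (Option E))) = 1 := by
    ext1 x
    apply Option.some_injective
    cases x with
    | none => rw [removeNone_none _ (by simp)]; simp
    | some x =>
      have : swap none (some none) (some (some x)) = some (some x) :=
        swap_apply_of_ne_of_ne (by simp) (by simp)
      rw [removeNone_some _ ⟨_, this⟩, this]; simp
  rw [h1, numCycles_option, if_neg (by simp), h2, removeNone_mul_optionCongr, h3, one_mul,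
    numCycles_option, removeNone_optionCongr, if_pos (by simp)]

/-- Both removed edges are skipped in the vertex permutation; by `numCycles_option` a vertex is lost
for each of the two skipped edges that is a fixed point at the moment it is skipped. -/
theorem numCycles_mul_insert [Finite E] (ψ : Option (Option E) ≃ F) (σ : Perm F) (τ : Pairing E) :
    numCycles (σ * (τ.insert ψ).1) = numCycles (cut ψ σ * τ.1) +
      (if removeNone (cutAux ψ σ) none = none then 1 else 0) +
      if cutAux ψ σ none = none then 1 else 0 := by
  have h1 : numCycles (σ * (τ.insert ψ).1) =
      numCycles (cutAux ψ σ * optionCongr (optionCongr τ.1)) := by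
    refine (numCycles_congr ψ fun x => ?_).symm
    have : (τ.insertAux).1 x = swap none (some none) (optionCongr (optionCongr τ.1) x) := rfl
    simp only [cutAux, Perm.mul_apply, ← this, permCongr_apply, symm_symm, apply_symm_apply,
      Pairing.insert, Pairing.congr_apply]
  rw [h1, numCycles_option, removeNone_mul_optionCongr, numCycles_option,
    removeNone_mul_optionCongr]
  simp [cut]

theorem cutAux_none (ψ : Option (Option E) ≃ F) (σ : Perm F) {x : Option (Option E)}
    (h : σ (ψ (some none)) = ψ x) : cutAux ψ σ none = x := by
  simp [cutAux, permCongr_apply, h]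

theorem cutAux_some_none (ψ : Option (Option E) ≃ F) (σ : Perm F) {x : Option (Option E)}
    (h : σ (ψ none) = ψ x) : cutAux ψ σ (some none) = x := by
  simp [cutAux, permCongr_apply, h]

theorem cutAux_some_some (ψ : Option (Option E) ≃ F) (σ : Perm F) {x : Option (Option E)} {y : E}
    (h : σ (ψ (some (some y))) = ψ x) : cutAux ψ σ (some (some y)) = x := by
  simp [cutAux, permCongr_apply, h, swap_apply_of_ne_of_ne]

end insertPair

/-! ### Disjoint unions -/

/-- Some element of `A` is paired with an element of `B`. -/
def Linked {A B : Type} (τ : Pairing (A ⊕ B)) : Prop := ∃ x y, τ.1 (Sum.inl x) = Sum.inr y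

/-- The union of two pairings. -/
def Pairing.sum {A B : Type} (τ : Pairing A) (τ' : Pairing B) : Pairing (A ⊕ B) :=
  ⟨Equiv.sumCongr τ.1 τ'.1, by
    constructor
    · rintro (x | x) <;> simp [τ.2.1, τ'.2.1]
    · rintro (x | x) <;> simp [τ.2.2, τ'.2.2]⟩

@[simp] theorem Pairing.sum_inl {A B : Type} (τ : Pairing A) (τ' : Pairing B) (x : A) :
    (τ.sum τ').1 (Sum.inl x) = Sum.inl (τ.1 x) := rfl

@[simp] theorem Pairing.sum_inr {A B : Type} (τ : Pairing A) (τ' : Pairing B) (x : B) :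
    (τ.sum τ').1 (Sum.inr x) = Sum.inr (τ'.1 x) := rfl

theorem not_linked_sum {A B : Type} (τ : Pairing A) (τ' : Pairing B) : ¬ Linked (τ.sum τ') := by
  rintro ⟨x, y, h⟩
  simp at h

theorem exists_sum_of_not_linked {A B : Type} [Finite A] [Finite B] (τ : Pairing (A ⊕ B))
    (h : ¬ Linked τ) : ∃ τ₁ τ₂, Pairing.sum τ₁ τ₂ = τ := by
  obtain ⟨⟨π, π'⟩, hπ⟩ := Perm.mem_sumCongrHom_range_of_perm_mapsTo_inl (σ := τ.1) (by
    rintro _ ⟨x, rfl⟩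
    cases hx : τ.1 (Sum.inl x) with
    | inl y => exact ⟨y, rfl⟩
    | inr y => exact absurd ⟨x, y, hx⟩ h)
  have h1 : ∀ x, τ.1 (Sum.inl x) = Sum.inl (π x) := fun x => by rw [← hπ]; rfl
  have h2 : ∀ x, τ.1 (Sum.inr x) = Sum.inr (π' x) := fun x => by rw [← hπ]; rfl
  refine ⟨⟨π, fun x => ?_, fun x hx => ?_⟩, ⟨π', fun x => ?_, fun x hx => ?_⟩, Subtype.ext hπ⟩
  · have := τ.2.1 (Sum.inl x)
    rw [h1, h1] at this
    exact Sum.inl_injective this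
  · exact τ.2.2 (Sum.inl x) (by rw [h1, hx])
  · have := τ.2.1 (Sum.inr x)
    rw [h2, h2] at this
    exact Sum.inr_injective this
  · exact τ.2.2 (Sum.inr x) (by rw [h2, hx])

/-- Pairings without links between `A` and `B` are pairs of pairings of `A` and `B`. -/
noncomputable def sumEquiv (A B : Type) [Finite A] [Finite B] :
    Pairing A × Pairing B ≃ {τ : Pairing (A ⊕ B) // ¬ Linked τ} :=
  Equiv.ofBijective (fun τ => ⟨τ.1.sum τ.2, not_linked_sum _ _⟩)
    ⟨fun τ τ' h => by
      have h' : (τ.1.sum τ.2).1 = (τ'.1.sum τ'.2).1 := congrArg Subtype.val (congrArg Subtype.val h)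
      refine Prod.ext (Subtype.ext (Equiv.ext fun x => ?_)) (Subtype.ext (Equiv.ext fun x => ?_))
      · exact Sum.inl_injective (DFunLike.congr_fun h' (Sum.inl x))
      · exact Sum.inr_injective (DFunLike.congr_fun h' (Sum.inr x)),
    fun ⟨τ, h⟩ => by
      obtain ⟨τ₁, τ₂, rfl⟩ := exists_sum_of_not_linked τ h
      exact ⟨(τ₁, τ₂), rfl⟩⟩

theorem card_not_linked {A B : Type} [Finite A] [Finite B] (P : Pairing (A ⊕ B) → Prop) :
    Nat.card {τ : Pairing (A ⊕ B) // ¬ Linked τ ∧ P τ} =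
      Nat.card {τ : Pairing A × Pairing B // P (τ.1.sum τ.2)} := by
  symm
  exact Nat.card_congr (((sumEquiv A B).subtypeEquiv
    (q := fun τ' => P τ'.1) fun τ => Iff.rfl).trans (Equiv.subtypeSubtypeEquivSubtypeInter _ _))

theorem defect_sum {A B : Type} [Finite A] [Finite B] (σ : Perm A) (σ' : Perm B) (τ : Pairing A)
    (τ' : Pairing B) :
    defect (Equiv.sumCongr σ σ') (τ.sum τ') = defect σ τ + defect σ' τ' := by
  have h : Equiv.sumCongr σ σ' * (τ.sum τ').1 = Equiv.sumCongr (σ * τ.1) (σ' * τ'.1) := by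
    ext1 (x | x) <;> rfl
  have h' : (τ.sum τ').1 = Equiv.sumCongr τ.1 τ'.1 := rfl
  unfold defect
  rw [h, h', numCycles_sumCongr, numCycles_sumCongr]
  push_cast
  ring

/-! ### Cutting a polygon in two and joining two polygons -/

theorem val_finRotate {n : ℕ} (i : Fin n) :
    (finRotate n i : ℕ) = if (i : ℕ) + 1 = n then 0 else (i : ℕ) + 1 := by
  cases n with
  | zero => exact i.elim0
  | succ n =>
    split_ifs with h
    · have : i = Fin.last n := Fin.ext (by simpa using h)
      rw [this, finRotate_last]
      rfl
    · exact coe_finRotate_of_ne_last fun h' => h (by simp [h'])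

theorem removeNone_of_some {E : Type} {π : Perm (Option E)} {x y : E}
    (h : π (some x) = some y) : removeNone π x = y := by
  apply Option.some_injective
  rw [removeNone_some _ ⟨_, h⟩, h]

theorem removeNone_of_none {E : Type} {π : Perm (Option E)} {x y : E}
    (h : π (some x) = none) (h' : π none = some y) : removeNone π x = y := by
  apply Option.some_injective
  rw [removeNone_none _ h, h']

/-- The edges `0` and `a + 1` of a polygon with `a + b + 2` edges, and the other edges of this
polygon: the `a` edges after the edge `0`, and the `b` edges after the edge `a + 1`. There may be
other polygons, whose edges form the type `R`. -/
noncomputable def splitEquiv (a b : ℕ) (R : Type) :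
    Option (Option ((Fin a ⊕ Fin b) ⊕ R)) ≃ Fin (a + b + 2) ⊕ R :=
  Equiv.ofBijective (fun
    | none => Sum.inl ⟨0, by omega⟩
    | some none => Sum.inl ⟨a + 1, by omega⟩
    | some (some (Sum.inl (Sum.inl i))) => Sum.inl ⟨i + 1, by omega⟩
    | some (some (Sum.inl (Sum.inr j))) => Sum.inl ⟨a + 2 + j, by omega⟩
    | some (some (Sum.inr r)) => Sum.inr r) <| by
  constructor
  · rintro (_ | _ | (i | i) | r) (_ | _ | (j | j) | s) h <;>
      simp only [Sum.inl.injEq, Sum.inr.injEq, Fin.mk.injEq, reduceCtorEq] at h <;>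
      first
        | rfl
        | omega
        | exact congrArg (fun x => some (some (Sum.inl (Sum.inl x)))) (Fin.ext (by omega))
        | exact congrArg (fun x => some (some (Sum.inl (Sum.inr x)))) (Fin.ext (by omega))
        | rw [h]
  · rintro (⟨x, hx⟩ | r)
    · rcases lt_trichotomy x (a + 1) with h | rfl | h
      · rcases Nat.eq_zero_or_pos x with rfl | h0
        · exact ⟨none, rfl⟩
        · exact ⟨some (some (Sum.inl (Sum.inl ⟨x - 1, by omega⟩))),
            congrArg Sum.inl (Fin.ext (Nat.sub_add_cancel h0))⟩
      · exact ⟨some none, rfl⟩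
      · exact ⟨some (some (Sum.inl (Sum.inr ⟨x - (a + 2), by omega⟩))),
          congrArg Sum.inl (Fin.ext (Nat.add_sub_cancel' h))⟩
    · exact ⟨some (some (Sum.inr r)), rfl⟩

section split

variable {a b : ℕ} {R : Type}

theorem splitEquiv_none : splitEquiv a b R none = Sum.inl ⟨0, by omega⟩ := rfl
theorem splitEquiv_some_none : splitEquiv a b R (some none) = Sum.inl ⟨a + 1, by omega⟩ := rfl
theorem splitEquiv_inl (i : Fin a) : splitEquiv a b R (some (some (Sum.inl (Sum.inl i)))) =
  Sum.inl ⟨i + 1, by omega⟩ := rfl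
theorem splitEquiv_inr (j : Fin b) : splitEquiv a b R (some (some (Sum.inl (Sum.inr j)))) =
  Sum.inl ⟨a + 2 + j, by omega⟩ := rfl
theorem splitEquiv_rest (r : R) : splitEquiv a b R (some (some (Sum.inr r))) = Sum.inr r := rfl

/-- Cutting a polygon at two edges that are glued together: one more vertex is lost for every part
without edges. -/
theorem defect_split [Finite R] [DecidableEq R] (σ : Perm R)
    (τ : Pairing ((Fin a ⊕ Fin b) ⊕ R)) :
    defect (Equiv.sumCongr (finRotate (a + b + 2)) σ) (τ.insert (splitEquiv a b R)) =
      defect (Equiv.sumCongr (Equiv.sumCongr (finRotate a) (finRotate b)) σ) τ + 1 -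
        (if a = 0 then 1 else 0) - (if b = 0 then 1 else 0) := by
  set ρ := cutAux (splitEquiv a b R) (Equiv.sumCongr (finRotate (a + b + 2)) σ) with hρ
  have e0 : b = 0 → ρ none = none := fun hb => by
    refine cutAux_none _ _ ?_
    simp only [splitEquiv_none, splitEquiv_some_none, sumCongr_apply, Sum.map_inl]
    exact congrArg Sum.inl (Fin.ext (by rw [val_finRotate, if_pos (by simp; omega)]))
  have e1 : ∀ hb : 0 < b, ρ none = some (some (Sum.inl (Sum.inr ⟨0, hb⟩))) := fun hb => by
    refine cutAux_none _ _ ?_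
    simp only [splitEquiv_inr, splitEquiv_some_none, sumCongr_apply, Sum.map_inl]
    exact congrArg Sum.inl (Fin.ext (by rw [val_finRotate, if_neg (by simp; omega)]))
  have f0 : a = 0 → ρ (some none) = some none := fun ha => by
    refine cutAux_some_none _ _ ?_
    simp only [splitEquiv_none, splitEquiv_some_none, sumCongr_apply, Sum.map_inl]
    exact congrArg Sum.inl (Fin.ext (by rw [val_finRotate, if_neg (by simp)]; simp [ha]))
  have f1 : ∀ ha : 0 < a, ρ (some none) = some (some (Sum.inl (Sum.inl ⟨0, ha⟩))) := fun ha => by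
    refine cutAux_some_none _ _ ?_
    simp only [splitEquiv_none, splitEquiv_inl, sumCongr_apply, Sum.map_inl]
    exact congrArg Sum.inl (Fin.ext (by rw [val_finRotate, if_neg (by simp)]))
  have hcut : cut (splitEquiv a b R) (Equiv.sumCongr (finRotate (a + b + 2)) σ) =
      Equiv.sumCongr (Equiv.sumCongr (finRotate a) (finRotate b)) σ := by
    ext1 ((i | j) | r)
    · by_cases hi : (i : ℕ) + 1 = a
      · have h1 : ρ (some (some (Sum.inl (Sum.inl i)))) = some none := by
          refine cutAux_some_some _ _ ?_
          simp only [splitEquiv_some_none, splitEquiv_inl, sumCongr_apply, Sum.map_inl]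
          exact congrArg Sum.inl (Fin.ext (by
            rw [val_finRotate, if_neg (by simp; omega)]; simp [hi]))
        refine removeNone_of_none (removeNone_of_some h1)
          (removeNone_of_some ((f1 (by omega)).trans ?_))
        exact congrArg (fun x => some (some (Sum.inl (Sum.inl x)))) (Fin.ext (by
          rw [val_finRotate, if_pos hi]))
      · refine removeNone_of_some (removeNone_of_some (cutAux_some_some _ _ ?_))
        simp only [splitEquiv_inl, sumCongr_apply, Sum.map_inl]
        exact congrArg Sum.inl (Fin.ext (by
          rw [val_finRotate, if_neg (by simp; omega)]
          simp only [val_finRotate, if_neg hi]))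
    · by_cases hj : (j : ℕ) + 1 = b
      · have h1 : ρ (some (some (Sum.inl (Sum.inr j)))) = none := by
          refine cutAux_some_some _ _ ?_
          simp only [splitEquiv_none, splitEquiv_inr, sumCongr_apply, Sum.map_inl]
          exact congrArg Sum.inl (Fin.ext (by
            rw [val_finRotate, if_pos (by simp; omega)]))
        refine removeNone_of_some (removeNone_of_none h1 ((e1 (by omega)).trans ?_))
        exact congrArg (fun x => some (some (Sum.inl (Sum.inr x)))) (Fin.ext (by
          rw [val_finRotate, if_pos hj]))
      · refine removeNone_of_some (removeNone_of_some (cutAux_some_some _ _ ?_))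
        simp only [splitEquiv_inr, sumCongr_apply, Sum.map_inl, Sum.map_inr]
        exact congrArg Sum.inl (Fin.ext (by
          rw [val_finRotate, if_neg (by simp; omega)]
          simp only [val_finRotate, if_neg hj, add_assoc]))
    · refine removeNone_of_some (removeNone_of_some (cutAux_some_some _ _ ?_))
      simp [splitEquiv_rest]
  have hc := numCycles_mul_insert (splitEquiv a b R)
    (Equiv.sumCongr (finRotate (a + b + 2)) σ) τ
  rw [hcut, ← hρ] at hc
  have h1 : (ρ none = none) ↔ b = 0 := by
    refine ⟨fun h => ?_, e0⟩
    by_contra hb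
    rw [e1 (by omega)] at h
    simp at h
  have h2 : (removeNone ρ none = none) ↔ a = 0 := by
    refine ⟨fun h => ?_, fun h => removeNone_of_some (f0 h)⟩
    by_contra ha
    rw [removeNone_of_some (f1 (by omega))] at h
    simp at h
  simp only [h1, h2] at hc
  unfold defect
  rw [numCycles_insert, hc]
  push_cast
  ring

end split

/-- The marked edges of a polygon with `a + 1` edges and of one with `b + 1` edges, and the other
edges of these polygons, in the order of the polygon that results when the two marked edges are
glued together and removed. -/
noncomputable def joinEquiv (a b : ℕ) :
    Option (Option (Fin (a + b))) ≃ Fin (a + 1) ⊕ Fin (b + 1) :=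
  Equiv.ofBijective (fun
    | none => Sum.inl ⟨0, by omega⟩
    | some none => Sum.inr ⟨0, by omega⟩
    | some (some i) => if h : (i : ℕ) < a then Sum.inl ⟨i + 1, by omega⟩
        else Sum.inr ⟨i - a + 1, by omega⟩) <| by
  rw [Fintype.bijective_iff_injective_and_card]
  refine ⟨?_, by simp; omega⟩
  rintro (_ | _ | i) (_ | _ | j) h <;> dsimp only at h <;> (try split_ifs at h) <;>
    simp only [Sum.inl.injEq, Sum.inr.injEq, Fin.mk.injEq, reduceCtorEq] at h <;>
    first
      | rfl
      | omega
      | exact congrArg (fun x => some (some x)) (Fin.ext (by omega))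

section join

variable {a b : ℕ}

theorem joinEquiv_none : joinEquiv a b none = Sum.inl ⟨0, by omega⟩ := rfl
theorem joinEquiv_some_none : joinEquiv a b (some none) = Sum.inr ⟨0, by omega⟩ := rfl
theorem joinEquiv_of_lt (i : Fin (a + b)) (h : (i : ℕ) < a) :
    joinEquiv a b (some (some i)) = Sum.inl ⟨i + 1, by omega⟩ := dif_pos h
theorem joinEquiv_of_not_lt (i : Fin (a + b)) (h : ¬ (i : ℕ) < a) :
    joinEquiv a b (some (some i)) = Sum.inr ⟨i - a + 1, by omega⟩ := dif_neg h

/-- Joining two polygons along their marked edges: a vertex is lost only if there are no other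
edges. -/
theorem defect_join (τ : Pairing (Fin (a + b))) :
    defect (Equiv.sumCongr (finRotate (a + 1)) (finRotate (b + 1))) (τ.insert (joinEquiv a b)) =
      defect (finRotate (a + b)) τ + 1 - if a + b = 0 then 1 else 0 := by
  set ρ := cutAux (joinEquiv a b) (Equiv.sumCongr (finRotate (a + 1)) (finRotate (b + 1))) with hρ
  have e0 : b = 0 → ρ none = some none := fun hb => by
    refine cutAux_none _ _ ?_
    simp only [joinEquiv_some_none, sumCongr_apply, Sum.map_inr]
    exact congrArg Sum.inr (Fin.ext (by rw [val_finRotate, if_pos (by simp; omega)]))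
  have e1 : ∀ hb : 0 < b, ρ none = some (some ⟨a, by omega⟩) := fun hb => by
    refine cutAux_none _ _ ?_
    rw [joinEquiv_of_not_lt _ (by simp), joinEquiv_some_none]
    simp only [sumCongr_apply, Sum.map_inr]
    exact congrArg Sum.inr (Fin.ext (by rw [val_finRotate, if_neg (by simp; omega)]; simp))
  have f0 : a = 0 → ρ (some none) = none := fun ha => by
    refine cutAux_some_none _ _ ?_
    simp only [joinEquiv_none, sumCongr_apply, Sum.map_inl]
    exact congrArg Sum.inl (Fin.ext (by rw [val_finRotate, if_pos (by simp; omega)]))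
  have f1 : ∀ ha : 0 < a, ρ (some none) = some (some ⟨0, by omega⟩) := fun ha => by
    refine cutAux_some_none _ _ ?_
    rw [joinEquiv_of_lt _ ha, joinEquiv_none]
    simp only [sumCongr_apply, Sum.map_inl]
    exact congrArg Sum.inl (Fin.ext (by rw [val_finRotate, if_neg (by simp; omega)]))
  have hcut : cut (joinEquiv a b) (Equiv.sumCongr (finRotate (a + 1)) (finRotate (b + 1))) =
      finRotate (a + b) := by
    ext1 i
    have hi' := i.2
    by_cases hi : (i : ℕ) < a
    · by_cases hl : (i : ℕ) + 1 = a
      · -- the last edge of the first polygon is followed by the removed edge `none`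
        have h1 : ρ (some (some i)) = none := by
          refine cutAux_some_some _ _ ?_
          rw [joinEquiv_of_lt _ hi, joinEquiv_none]
          simp only [sumCongr_apply, Sum.map_inl]
          exact congrArg Sum.inl (Fin.ext (by rw [val_finRotate, if_pos (by simp; omega)]))
        rcases Nat.eq_zero_or_pos b with hb | hb
        · refine removeNone_of_none (removeNone_of_none h1 (e0 hb))
            (removeNone_of_some ((f1 (by omega)).trans ?_))
          exact congrArg (fun x => some (some x)) (Fin.ext (by
            rw [val_finRotate, if_pos (by omega)]))
        · refine removeNone_of_some (removeNone_of_none h1 ((e1 hb).trans ?_))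
          exact congrArg (fun x => some (some x)) (Fin.ext (by
            rw [val_finRotate, if_neg (by omega)]; simp [hl]))
      · refine removeNone_of_some (removeNone_of_some (cutAux_some_some _ _ ?_))
        rw [joinEquiv_of_lt _ hi, joinEquiv_of_lt _ (by rw [val_finRotate, if_neg] <;> omega)]
        simp only [sumCongr_apply, Sum.map_inl]
        exact congrArg Sum.inl (Fin.ext (by
          rw [val_finRotate, if_neg (by simp; omega)]
          simp only [val_finRotate]
          rw [if_neg (by omega)]))
    · by_cases hl : (i : ℕ) + 1 = a + b
      · have h1 : ρ (some (some i)) = some none := by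
          refine cutAux_some_some _ _ ?_
          rw [joinEquiv_of_not_lt _ hi, joinEquiv_some_none]
          simp only [sumCongr_apply, Sum.map_inr]
          exact congrArg Sum.inr (Fin.ext (by rw [val_finRotate, if_pos (by simp; omega)]))
        rcases Nat.eq_zero_or_pos a with ha | ha
        · refine removeNone_of_none (removeNone_of_some h1)
            (removeNone_of_none (f0 ha) ((e1 (by omega)).trans ?_))
          exact congrArg (fun x => some (some x)) (Fin.ext (by
            rw [val_finRotate, if_pos (by omega)]; exact ha))
        · refine removeNone_of_none (removeNone_of_some h1)
            (removeNone_of_some ((f1 ha).trans ?_))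
          exact congrArg (fun x => some (some x)) (Fin.ext (by
            rw [val_finRotate, if_pos (by omega)]))
      · refine removeNone_of_some (removeNone_of_some (cutAux_some_some _ _ ?_))
        rw [joinEquiv_of_not_lt _ hi,
          joinEquiv_of_not_lt _ (by rw [val_finRotate, if_neg] <;> omega)]
        simp only [sumCongr_apply, Sum.map_inr]
        exact congrArg Sum.inr (Fin.ext (by
          rw [val_finRotate, if_neg (by simp; omega)]
          simp only [val_finRotate]
          rw [if_neg (by omega)]; omega))
  have hc := numCycles_mul_insert (joinEquiv a b)
    (Equiv.sumCongr (finRotate (a + 1)) (finRotate (b + 1))) τ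
  rw [hcut, ← hρ] at hc
  have h1 : ρ none ≠ none := fun h => by
    rcases Nat.eq_zero_or_pos b with hb | hb
    · rw [e0 hb] at h
      simp at h
    · rw [e1 hb] at h
      simp at h
  have h2 : (removeNone ρ none = none) ↔ a + b = 0 := by
    refine ⟨fun h => ?_, fun h => removeNone_of_none (f0 (by omega)) (e0 (by omega))⟩
    by_contra hab
    rcases Nat.eq_zero_or_pos a with ha | ha
    · rw [removeNone_of_none (f0 ha) (e1 (by omega))] at h
      simp at h
    · rw [removeNone_of_some (f1 ha)] at h
      simp at h
  rw [if_neg h1] at hc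
  simp only [h2] at hc
  unfold defect
  rw [numCycles_insert, hc]
  push_cast
  ring

end join

/-! ### Twice the genus of gluings of one, two or three polygons -/

/-- `1` for a polygon without edges, whose vertex is not counted by `numCycles`, and `0` for any
other polygon. -/
def extraVertex (a : ℕ) : ℤ := if a = 0 then 1 else 0

/-- Twice the genus of the surface glued from one polygon; a polygon without edges counts as a
sphere with one vertex. -/
noncomputable def doubleGenus₁ {a : ℕ} (τ : Pairing (Fin a)) : ℤ :=
  defect (finRotate a) τ + 1 - extraVertex a

/-- Twice the genus of a connected surface glued from two polygons. -/
noncomputable def doubleGenus₂ {a b : ℕ} (τ : Pairing (Fin a ⊕ Fin b)) : ℤ :=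
  defect (Equiv.sumCongr (finRotate a) (finRotate b)) τ - extraVertex a - extraVertex b

/-- Twice the genus of a connected surface glued from three polygons. -/
noncomputable def doubleGenus₃ {a b c : ℕ} (τ : Pairing ((Fin a ⊕ Fin b) ⊕ Fin c)) : ℤ :=
  defect (Equiv.sumCongr (Equiv.sumCongr (finRotate a) (finRotate b)) (finRotate c)) τ - 1
    - extraVertex a - extraVertex b - extraVertex c

/-- The union of two separate gluings; here `doubleGenus₂` is not twice the genus of a connected
surface, but it is what cutting a polygon in two leads to. -/
theorem doubleGenus₂_sum {a b : ℕ} (τ : Pairing (Fin a)) (τ' : Pairing (Fin b)) :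
    doubleGenus₂ (τ.sum τ') + 2 = doubleGenus₁ τ + doubleGenus₁ τ' := by
  unfold doubleGenus₂ doubleGenus₁
  rw [defect_sum]
  ring

theorem defect_sumEmpty {E : Type} (σ : Perm E) (τ : Pairing (E ⊕ Empty)) :
    defect σ (Pairing.congr (Equiv.sumEmpty E Empty) τ) = defect (Equiv.sumCongr σ 1) τ :=
  defect_congr _ (by rintro (x | x) <;> [rfl; exact x.elim]) τ

theorem doubleGenus₁_insert {a b : ℕ} (τ : Pairing ((Fin a ⊕ Fin b) ⊕ Empty)) :
    doubleGenus₁ (Pairing.congr (Equiv.sumEmpty (Fin (a + b + 2)) Empty)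
      (τ.insert (splitEquiv a b Empty))) =
    doubleGenus₂ (Pairing.congr (Equiv.sumEmpty _ _) τ) + 2 := by
  unfold doubleGenus₂ doubleGenus₁ extraVertex
  rw [defect_sumEmpty, defect_sumEmpty, defect_split, if_neg (by omega : ¬ a + b + 2 = 0)]
  ring

theorem doubleGenus₂_insert {a b c : ℕ} (τ : Pairing ((Fin a ⊕ Fin b) ⊕ Fin c)) :
    doubleGenus₂ (τ.insert (splitEquiv a b (Fin c))) = doubleGenus₃ τ + 2 := by
  unfold doubleGenus₂ doubleGenus₃ extraVertex
  rw [defect_split, if_neg (by omega : ¬ a + b + 2 = 0)]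
  ring

theorem linked_insert {a b c : ℕ} (τ : Pairing ((Fin a ⊕ Fin b) ⊕ Fin c)) :
    Linked (τ.insert (splitEquiv a b (Fin c))) ↔ Linked τ := by
  constructor
  · rintro ⟨x, y, h⟩
    obtain ⟨_ | _ | (z | z), hz⟩ := (splitEquiv a b (Fin c)).surjective (Sum.inl x)
    · rw [← hz, Pairing.insert_none, splitEquiv_some_none] at h
      simp at h
    · rw [← hz, Pairing.insert_some_none, splitEquiv_none] at h
      simp at h
    · rw [← hz, Pairing.insert_some_some, ← splitEquiv_rest,
        (splitEquiv a b (Fin c)).injective.eq_iff] at h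
      exact ⟨z, y, by simpa using h⟩
    · simp [splitEquiv_rest] at hz
  · rintro ⟨x | x, y, h⟩
    · exact ⟨_, y, by rw [← splitEquiv_inl, Pairing.insert_some_some, h, splitEquiv_rest]⟩
    · exact ⟨_, y, by rw [← splitEquiv_inr, Pairing.insert_some_some, h, splitEquiv_rest]⟩

/-- The identification of `joinEquiv`, for any two edges of the two polygons in the place of the
marked ones. -/
noncomputable def joinEquivAt {a b : ℕ} (i : Fin (a + 1)) (j : Fin (b + 1)) :
    Option (Option (Fin (a + b))) ≃ Fin (a + 1) ⊕ Fin (b + 1) :=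
  (joinEquiv a b).trans (Equiv.sumCongr (Equiv.addRight i) (Equiv.addRight j))

theorem joinEquivAt_none {a b : ℕ} (i : Fin (a + 1)) (j : Fin (b + 1)) :
    joinEquivAt i j none = Sum.inl i := by
  simp [joinEquivAt, joinEquiv_none]

theorem joinEquivAt_some_none {a b : ℕ} (i : Fin (a + 1)) (j : Fin (b + 1)) :
    joinEquivAt i j (some none) = Sum.inr j := by
  simp [joinEquivAt, joinEquiv_some_none]

theorem doubleGenus₂_insert_join {a b : ℕ} (i : Fin (a + 1)) (j : Fin (b + 1))
    (τ : Pairing (Fin (a + b))) :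
    doubleGenus₂ (τ.insert (joinEquivAt i j)) = doubleGenus₁ τ := by
  have h : τ.insert (joinEquivAt i j) = Pairing.congr
      (Equiv.sumCongr (Equiv.addRight i) (Equiv.addRight j)) (τ.insert (joinEquiv a b)) := rfl
  unfold doubleGenus₂ doubleGenus₁ extraVertex
  rw [h, defect_congr (σ := Equiv.sumCongr (finRotate (a + 1)) (finRotate (b + 1))), defect_join]
  · simp
  · rintro (x | x)
    · simp [add_right_comm]
    · simp [add_right_comm]

theorem linked_insert_join {a b : ℕ} (i : Fin (a + 1)) (j : Fin (b + 1))
    (τ : Pairing (Fin (a + b))) : Linked (τ.insert (joinEquivAt i j)) :=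
  ⟨i, j, by rw [← joinEquivAt_none i j, Pairing.insert_none, joinEquivAt_some_none]⟩

/-- Two polygons that are glued together have the genus of the polygon that results when they are
joined along a common edge. So the parity and the sign of `doubleGenus₂` reduce to fewer edges. -/
theorem exists_join {a b : ℕ} (τ : Pairing (Fin a ⊕ Fin b)) (h : Linked τ) :
    ∃ c, c < a + b ∧ ∃ τ' : Pairing (Fin c), doubleGenus₂ τ = doubleGenus₁ τ' := by
  obtain ⟨i, j, h⟩ := h
  obtain _ | a := a
  · exact i.elim0
  obtain _ | b := b
  · exact j.elim0
  rw [← joinEquivAt_none i j, ← joinEquivAt_some_none i j] at h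
  obtain ⟨τ', rfl⟩ := Pairing.exists_insert _ τ h
  exact ⟨a + b, by omega, τ', doubleGenus₂_insert_join i j τ'⟩

/-- Euler's formula for one polygon: its gluings are surfaces of some genus. -/
theorem exists_doubleGenus₁_eq (a : ℕ) (τ : Pairing (Fin a)) :
    ∃ h : ℕ, doubleGenus₁ τ = 2 * (h : ℤ) := by
  induction a using Nat.strong_induction_on with
  | _ a ih =>
    match a with
    | 0 => exact ⟨0, by simp [doubleGenus₁, defect_of_isEmpty, extraVertex]⟩
    | 1 => exact absurd (Subsingleton.elim _ _) (τ.2.2 0)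
    | N + 2 =>
      obtain ⟨τ, rfl⟩ := (Pairing.congr (Equiv.sumEmpty (Fin (N + 2)) Empty)).surjective τ
      obtain ⟨y, hy⟩ : ∃ y, τ.1 (Sum.inl 0) = Sum.inl y := by
        rcases τ.1 (Sum.inl 0) with y | y
        · exact ⟨y, rfl⟩
        · exact y.elim
      obtain ⟨y, hyN⟩ := y
      have hy0 : y ≠ 0 := by
        rintro rfl
        exact τ.2.2 _ hy
      obtain ⟨a, rfl⟩ : ∃ a, y = a + 1 := ⟨y - 1, by omega⟩
      obtain ⟨b, rfl⟩ : ∃ b, N = a + b := ⟨N - a, by omega⟩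
      obtain ⟨τ, rfl⟩ := Pairing.exists_insert (splitEquiv a b Empty) τ hy
      rw [doubleGenus₁_insert]
      set τ' : Pairing (Fin a ⊕ Fin b) := Pairing.congr (Equiv.sumEmpty _ _) τ
      by_cases hl : Linked τ'
      · obtain ⟨c, hc, τ'', h⟩ := exists_join τ' hl
        obtain ⟨k, hk⟩ := ih c (by omega) τ''
        exact ⟨k + 1, by rw [h, hk]; push_cast; ring⟩
      · obtain ⟨τ₁, τ₂, hτ⟩ := exists_sum_of_not_linked τ' hl
        obtain ⟨k, hk⟩ := ih a (by omega) τ₁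
        obtain ⟨l, hl⟩ := ih b (by omega) τ₂
        exact ⟨k + l, by rw [← hτ, doubleGenus₂_sum, hk, hl]; push_cast; ring⟩

/-- Euler's formula for two polygons: their connected gluings are surfaces of some genus. -/
theorem exists_doubleGenus₂_eq {a b : ℕ} (τ : Pairing (Fin a ⊕ Fin b)) (hτ : Linked τ) :
    ∃ h : ℕ, doubleGenus₂ τ = 2 * (h : ℤ) := by
  obtain ⟨c, -, τ', h⟩ := exists_join τ hτ
  rw [h]
  exact exists_doubleGenus₁_eq c τ'

/-! ### Counting -/

theorem card_eq_add_card_not {X : Type} [Finite X] (P Q : X → Prop) :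
    Nat.card {x // P x} = Nat.card {x // Q x ∧ P x} + Nat.card {x // ¬ Q x ∧ P x} := by
  classical
  have := Fintype.ofFinite X
  simp only [Nat.card_eq_fintype_card, Fintype.card_subtype]
  rw [← Finset.card_filter_add_card_filter_not (s := univ.filter P) Q, filter_filter, filter_filter]
  simp only [and_comm]

theorem card_eq_sum_fiber {X Y : Type} [Finite X] [Fintype Y] (f : X → Y) (P : X → Prop) :
    Nat.card {x // P x} = ∑ y, Nat.card {x // f x = y ∧ P x} := by
  classical
  have := Fintype.ofFinite X
  simp only [Nat.card_eq_fintype_card, Fintype.card_subtype]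
  rw [Finset.card_eq_sum_card_fiberwise (f := f) (t := univ) (by simp)]
  simp only [filter_filter, and_comm]

/-- Counting pairs by the genera of their two members. -/
theorem card_prod_double {X Y : Type} [Finite X] [Finite Y] (f : X → ℤ) (f' : Y → ℤ)
    (Q : Y → Prop) (hf : ∀ x, ∃ h : ℕ, f x = 2 * (h : ℤ))
    (hf' : ∀ y, Q y → ∃ h : ℕ, f' y = 2 * (h : ℤ)) (G : ℕ) :
    Nat.card {p : X × Y // Q p.2 ∧ f p.1 + f' p.2 = 2 * (G : ℤ)} =
      ∑ h ∈ range (G + 1), Nat.card {x // f x = 2 * (h : ℤ)} *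
        Nat.card {y // Q y ∧ f' y = 2 * ((G - h : ℕ) : ℤ)} := by
  classical
  have := Fintype.ofFinite X
  have := Fintype.ofFinite Y
  choose k hk using hf
  simp only [Nat.card_eq_fintype_card, Fintype.card_subtype]
  rw [Finset.card_eq_sum_card_fiberwise (f := fun p => k p.1) (t := range (G + 1))]
  · refine sum_congr rfl fun h hh => ?_
    rw [← card_product]
    congr 1
    ext ⟨x, y⟩
    have hh' := mem_range.1 hh
    have := hk x
    simp only [mem_filter, mem_univ, true_and, mem_product]
    constructor
    · rintro ⟨⟨h1, h2⟩, h3⟩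
      refine ⟨by omega, h1, by omega⟩
    · rintro ⟨h1, h2, h3⟩
      exact ⟨⟨h2, by omega⟩, by omega⟩
  · intro p hp
    simp only [coe_filter, mem_univ, true_and, Set.mem_ofPred_eq] at hp
    obtain ⟨l, hl⟩ := hf' p.2 hp.1
    have := hk p.1
    simp only [coe_range, Set.mem_Iio]
    omega

/-- The pairings of the edges of several polygons, classified by the edge that is paired with the
marked edge of the first polygon. -/
theorem card_eq_split_add {R : Type} [Fintype R] [DecidableEq R]
    (P : ∀ {M : ℕ}, Pairing (Fin M ⊕ R) → Prop) (N : ℕ) :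
    Nat.card {τ : Pairing (Fin (N + 2) ⊕ R) // P τ} =
      ∑ p ∈ antidiagonal N, Nat.card {τ : Pairing ((Fin p.1 ⊕ Fin p.2) ⊕ R) //
        P (τ.insert (splitEquiv p.1 p.2 R))} +
      ∑ r : R, Nat.card {τ : Pairing (Fin (N + 2) ⊕ R) // τ.1 (Sum.inl 0) = Sum.inr r ∧ P τ} := by
  rw [card_eq_sum_fiber (fun τ => τ.1 (Sum.inl 0)), Fintype.sum_sum_type]
  congr 1
  set f : ℕ → ℕ := fun k => Nat.card {τ : Pairing (Fin (N + 2) ⊕ R) //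
    (∃ y : Fin (N + 2), τ.1 (Sum.inl 0) = Sum.inl y ∧ (y : ℕ) = k) ∧ P τ} with hf
  have h1 : ∀ y : Fin (N + 2), Nat.card {τ : Pairing (Fin (N + 2) ⊕ R) //
      τ.1 (Sum.inl 0) = Sum.inl y ∧ P τ} = f y := fun y => by
    refine Nat.card_congr (Equiv.subtypeEquivRight fun τ => and_congr_left fun _ => ?_)
    constructor
    · exact fun h => ⟨y, h, rfl⟩
    · rintro ⟨z, hz, hzy⟩
      rwa [← Fin.ext hzy]
  have h0 : f 0 = 0 := by
    rw [hf]
    refine @Nat.card_of_isEmpty _ ⟨?_⟩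
    rintro ⟨τ, ⟨y, hy, hy0⟩, -⟩
    have : y = 0 := Fin.ext hy0
    exact τ.2.2 _ (this ▸ hy)
  rw [Finset.sum_congr rfl fun y _ => h1 y, Fin.sum_univ_eq_sum_range f, sum_range_succ', h0,
    add_zero, ← Nat.succ_eq_add_one N,
    ← Nat.sum_antidiagonal_eq_sum_range_succ_mk (fun p => f (p.1 + 1))]
  refine sum_congr rfl ?_
  rintro ⟨a, b⟩ hab
  rw [HasAntidiagonal.mem_antidiagonal] at hab
  dsimp only at hab ⊢
  subst hab
  rw [← card_insert, hf]
  refine Nat.card_congr (Equiv.subtypeEquivRight fun τ => and_congr_left fun _ => ?_)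
  rw [splitEquiv_none, splitEquiv_some_none]
  constructor
  · rintro ⟨y, hy, hya⟩
    exact hy.trans (congrArg Sum.inl (Fin.ext hya))
  · exact fun h => ⟨_, h, rfl⟩

/-- The number of gluings of an `a`-gon with twice the genus equal to `w`. -/
noncomputable def count₁ (a : ℕ) (w : ℤ) : ℕ := Nat.card {τ : Pairing (Fin a) // doubleGenus₁ τ = w}

/-- The number of connected gluings of an `a`-gon and a `b`-gon with twice the genus equal to
`w`. -/
noncomputable def count₂ (a b : ℕ) (w : ℤ) : ℕ :=
  Nat.card {τ : Pairing (Fin a ⊕ Fin b) // Linked τ ∧ doubleGenus₂ τ = w}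

/-- Cutting a polygon along its marked edge and the edge that this is glued to: the two parts are
either glued together, which lowers the genus by one, or glued separately, and then the genus is the
sum of the two genera. -/
theorem count₁_add_two (N G : ℕ) :
    count₁ (N + 2) (2 * (G : ℤ)) = ∑ p ∈ antidiagonal N, (count₂ p.1 p.2 (2 * (G : ℤ) - 2) +
      ∑ h ∈ range (G + 1), count₁ p.1 (2 * (h : ℤ)) * count₁ p.2 (2 * ((G - h : ℕ) : ℤ))) := by
  have h0 : count₁ (N + 2) (2 * (G : ℤ)) = Nat.card {τ : Pairing (Fin (N + 2) ⊕ Empty) //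
      doubleGenus₁ (Pairing.congr (Equiv.sumEmpty _ _) τ) = 2 * (G : ℤ)} :=
    (Nat.card_congr ((Pairing.congr (Equiv.sumEmpty _ _)).subtypeEquiv fun τ => Iff.rfl)).symm
  rw [h0, card_eq_split_add (R := Empty)
    (fun τ => doubleGenus₁ (Pairing.congr (Equiv.sumEmpty _ _) τ) = 2 * (G : ℤ)) N]
  simp only [univ_eq_empty, sum_empty, add_zero]
  refine sum_congr rfl fun p _ => ?_
  have h1 : Nat.card {τ : Pairing ((Fin p.1 ⊕ Fin p.2) ⊕ Empty) //
      doubleGenus₁ (Pairing.congr (Equiv.sumEmpty _ _) (τ.insert (splitEquiv p.1 p.2 Empty))) =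
        2 * (G : ℤ)} =
      Nat.card {τ : Pairing (Fin p.1 ⊕ Fin p.2) // doubleGenus₂ τ = 2 * (G : ℤ) - 2} :=
    Nat.card_congr ((Pairing.congr (Equiv.sumEmpty _ _)).subtypeEquiv fun τ => by
      rw [doubleGenus₁_insert, eq_sub_iff_add_eq])
  rw [h1, card_eq_add_card_not _ Linked, card_not_linked]
  congr 1
  have h2 := card_prod_double (doubleGenus₁ (a := p.1)) (doubleGenus₁ (a := p.2)) (fun _ => True)
    (exists_doubleGenus₁_eq _) (fun τ _ => exists_doubleGenus₁_eq _ τ) G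
  simp only [true_and] at h2
  refine Eq.trans ?_ h2
  refine Nat.card_congr (Equiv.subtypeEquivRight fun τ => ?_)
  rw [← doubleGenus₂_sum, eq_sub_iff_add_eq]

section three

variable {A B C : Type}

/-- An element of `A` is paired with an element of `B`. -/
def Linked₁₂ (τ : Pairing ((A ⊕ B) ⊕ C)) : Prop :=
  ∃ x y, τ.1 (Sum.inl (Sum.inl x)) = Sum.inl (Sum.inr y)

/-- An element of `A` is paired with an element of `C`. -/
def Linked₁₃ (τ : Pairing ((A ⊕ B) ⊕ C)) : Prop := ∃ x y, τ.1 (Sum.inl (Sum.inl x)) = Sum.inr y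

/-- An element of `B` is paired with an element of `C`. -/
def Linked₂₃ (τ : Pairing ((A ⊕ B) ⊕ C)) : Prop := ∃ x y, τ.1 (Sum.inl (Sum.inr x)) = Sum.inr y

/-- The three parts are connected by links. -/
def Connected₃ (τ : Pairing ((A ⊕ B) ⊕ C)) : Prop :=
  (Linked₁₃ τ ∧ Linked₂₃ τ) ∨ (Linked₁₂ τ ∧ (Linked₁₃ τ ∨ Linked₂₃ τ))

theorem linked_iff_or (τ : Pairing ((A ⊕ B) ⊕ C)) : Linked τ ↔ Linked₁₃ τ ∨ Linked₂₃ τ := by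
  constructor
  · rintro ⟨x | x, y, h⟩
    · exact Or.inl ⟨x, y, h⟩
    · exact Or.inr ⟨x, y, h⟩
  · rintro (⟨x, y, h⟩ | ⟨x, y, h⟩)
    · exact ⟨_, y, h⟩
    · exact ⟨_, y, h⟩

/-- Exchanging the first two summands. -/
def swapFirst (A B C : Type) : (A ⊕ B) ⊕ C ≃ (B ⊕ A) ⊕ C :=
  Equiv.sumCongr (Equiv.sumComm A B) (Equiv.refl C)

/-- Moving the second summand to the front. -/
def secondFirst (A B C : Type) : (A ⊕ B) ⊕ C ≃ B ⊕ (A ⊕ C) :=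
  (swapFirst A B C).trans (Equiv.sumAssoc B A C)

theorem linked₁₂_swapFirst (τ : Pairing ((A ⊕ B) ⊕ C)) :
    Linked₁₂ (Pairing.congr (swapFirst A B C) τ) ↔ Linked₁₂ τ := by
  have key : ∀ x y, (Pairing.congr (swapFirst A B C) τ).1 (Sum.inl (Sum.inl x)) =
      Sum.inl (Sum.inr y) ↔ τ.1 (Sum.inl (Sum.inr x)) = Sum.inl (Sum.inl y) := fun x y => by
    rw [← (swapFirst A B C).injective.eq_iff, ← Pairing.congr_apply]
    rfl
  constructor
  · rintro ⟨x, y, h⟩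
    exact ⟨y, x, by rw [← (key x y).1 h, τ.2.1]⟩
  · rintro ⟨x, y, h⟩
    exact ⟨y, x, (key y x).2 (by rw [← h, τ.2.1])⟩

theorem linked₁₃_swapFirst (τ : Pairing ((A ⊕ B) ⊕ C)) :
    Linked₁₃ (Pairing.congr (swapFirst A B C) τ) ↔ Linked₂₃ τ := by
  refine exists_congr fun x => exists_congr fun y => ?_
  rw [← (swapFirst A B C).injective.eq_iff, ← Pairing.congr_apply]
  rfl

theorem linked₂₃_swapFirst (τ : Pairing ((A ⊕ B) ⊕ C)) :
    Linked₂₃ (Pairing.congr (swapFirst A B C) τ) ↔ Linked₁₃ τ := by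
  refine exists_congr fun x => exists_congr fun y => ?_
  rw [← (swapFirst A B C).injective.eq_iff, ← Pairing.congr_apply]
  rfl

theorem linked_secondFirst (τ : Pairing ((A ⊕ B) ⊕ C)) :
    Linked (Pairing.congr (secondFirst A B C) τ) ↔ Linked₁₂ τ ∨ Linked₂₃ τ := by
  have key1 : ∀ x y, (Pairing.congr (secondFirst A B C) τ).1 (Sum.inl x) =
      Sum.inr (Sum.inl y) ↔ τ.1 (Sum.inl (Sum.inr x)) = Sum.inl (Sum.inl y) := fun x y => by
    rw [← (secondFirst A B C).injective.eq_iff, ← Pairing.congr_apply]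
    rfl
  have key2 : ∀ x y, (Pairing.congr (secondFirst A B C) τ).1 (Sum.inl x) =
      Sum.inr (Sum.inr y) ↔ τ.1 (Sum.inl (Sum.inr x)) = Sum.inr y := fun x y => by
    rw [← (secondFirst A B C).injective.eq_iff, ← Pairing.congr_apply]
    rfl
  constructor
  · rintro ⟨x, y | y, h⟩
    · exact Or.inl ⟨y, x, by rw [← (key1 x y).1 h, τ.2.1]⟩
    · exact Or.inr ⟨x, y, (key2 x y).1 h⟩
  · rintro (⟨x, y, h⟩ | ⟨x, y, h⟩)
    · exact ⟨y, _, (key1 y x).2 (by rw [← h, τ.2.1])⟩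
    · exact ⟨x, _, (key2 x y).2 h⟩

theorem linked₁₃_sum (τ : Pairing B) (τ' : Pairing (A ⊕ C)) :
    Linked₁₃ ((Pairing.congr (secondFirst A B C)).symm (τ.sum τ')) ↔ Linked τ' := by
  refine exists_congr fun x => exists_congr fun y => ?_
  rw [← (secondFirst A B C).injective.eq_iff, ← Pairing.congr_apply, Equiv.apply_symm_apply]
  change (τ.sum τ').1 (Sum.inr (Sum.inl x)) = Sum.inr (Sum.inr y) ↔ _
  rw [Pairing.sum_inr, Sum.inr_injective.eq_iff]

end three

/-- The number of connected gluings of an `a`-gon, a `b`-gon and a `c`-gon with twice the genus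
equal to `w`. -/
noncomputable def count₃ (a b c : ℕ) (w : ℤ) : ℕ :=
  Nat.card {τ : Pairing ((Fin a ⊕ Fin b) ⊕ Fin c) // Connected₃ τ ∧ doubleGenus₃ τ = w}

theorem doubleGenus₃_swapFirst {a b c : ℕ} (τ : Pairing ((Fin a ⊕ Fin b) ⊕ Fin c)) :
    doubleGenus₃ (Pairing.congr (swapFirst _ _ _) τ) = doubleGenus₃ τ := by
  unfold doubleGenus₃
  rw [defect_congr (swapFirst (Fin a) (Fin b) (Fin c))
    (σ := Equiv.sumCongr (Equiv.sumCongr (finRotate a) (finRotate b)) (finRotate c))]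
  · ring
  · rintro ((x | x) | x) <;> rfl

theorem doubleGenus₃_sum {a b c : ℕ} (τ : Pairing (Fin b)) (τ' : Pairing (Fin a ⊕ Fin c)) :
    doubleGenus₃ ((Pairing.congr (secondFirst _ _ _)).symm (τ.sum τ')) + 2 =
      doubleGenus₁ τ + doubleGenus₂ τ' := by
  unfold doubleGenus₃ doubleGenus₁ doubleGenus₂
  rw [← defect_congr (secondFirst (Fin a) (Fin b) (Fin c))
    (σ' := Equiv.sumCongr (finRotate b) (Equiv.sumCongr (finRotate a) (finRotate c))),
    Equiv.apply_symm_apply, defect_sum]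
  · ring
  · rintro ((x | x) | x) <;> rfl

/-- The gluings of three polygons into a surface with two components, one of which is glued from
the second polygon alone. -/
theorem card_only_linked₁₃ (a b c G : ℕ) :
    Nat.card {τ : Pairing ((Fin a ⊕ Fin b) ⊕ Fin c) //
      (Linked₁₃ τ ∧ ¬ Linked₁₂ τ ∧ ¬ Linked₂₃ τ) ∧ doubleGenus₃ τ = 2 * (G : ℤ) - 2} =
    ∑ h ∈ range (G + 1), count₁ b (2 * (h : ℤ)) * count₂ a c (2 * ((G - h : ℕ) : ℤ)) := by
  have h2 := card_prod_double (doubleGenus₁ (a := b)) (doubleGenus₂ (a := a) (b := c)) Linked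
    (exists_doubleGenus₁_eq _) (fun τ h => exists_doubleGenus₂_eq τ h) G
  refine Eq.trans ?_ h2
  refine Eq.trans ?_ ((card_not_linked (A := Fin b) (B := Fin a ⊕ Fin c) fun τ =>
    Linked₁₃ ((Pairing.congr (secondFirst _ _ _)).symm τ) ∧
      doubleGenus₃ ((Pairing.congr (secondFirst _ _ _)).symm τ) = 2 * (G : ℤ) - 2).trans ?_)
  · refine Nat.card_congr ((Pairing.congr (secondFirst _ _ _)).subtypeEquiv fun τ => ?_)
    rw [linked_secondFirst, Equiv.symm_apply_apply]
    tauto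
  · refine Nat.card_congr (Equiv.subtypeEquivRight fun τ => ?_)
    rw [linked₁₃_sum, ← doubleGenus₃_sum, eq_sub_iff_add_eq]

/-- After the first of two polygons, glued to a connected surface, has been cut into the parts `a` and
`b`, the surface is connected or has two components, one of which is glued from one of these parts. -/
theorem card_linked_eq (a b c G : ℕ) :
    Nat.card {τ : Pairing ((Fin a ⊕ Fin b) ⊕ Fin c) //
      Linked τ ∧ doubleGenus₃ τ = 2 * (G : ℤ) - 2} =
    count₃ a b c (2 * (G : ℤ) - 2) +
    ∑ h ∈ range (G + 1), count₁ b (2 * (h : ℤ)) * count₂ a c (2 * ((G - h : ℕ) : ℤ)) +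
    ∑ h ∈ range (G + 1), count₁ a (2 * (h : ℤ)) * count₂ b c (2 * ((G - h : ℕ) : ℤ)) := by
  rw [← card_only_linked₁₃, ← card_only_linked₁₃, card_eq_add_card_not _ Connected₃,
    card_eq_add_card_not (fun τ => ¬ Connected₃ τ ∧ _) Linked₁₃, ← add_assoc]
  congr 1
  · congr 1
    · refine Nat.card_congr (Equiv.subtypeEquivRight fun τ => ?_)
      rw [linked_iff_or, Connected₃]
      tauto
    · refine Nat.card_congr (Equiv.subtypeEquivRight fun τ => ?_)
      rw [linked_iff_or, Connected₃]
      tauto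
  · refine Nat.card_congr ((Pairing.congr (swapFirst _ _ _)).subtypeEquiv fun τ => ?_)
    rw [linked₁₂_swapFirst, linked₁₃_swapFirst, linked₂₃_swapFirst, doubleGenus₃_swapFirst,
      linked_iff_or, Connected₃]
    tauto

/-- Rotations of the second polygon show that the choice of its edge `r` does not matter. -/
theorem card_join (a b : ℕ) (r : Fin (b + 1)) (w : ℤ) :
    Nat.card {τ : Pairing (Fin (a + 1) ⊕ Fin (b + 1)) //
      τ.1 (Sum.inl 0) = Sum.inr r ∧ Linked τ ∧ doubleGenus₂ τ = w} = count₁ (a + b) w := by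
  have h := card_insert (joinEquivAt (a := a) 0 r) fun τ => Linked τ ∧ doubleGenus₂ τ = w
  rw [joinEquivAt_none, joinEquivAt_some_none] at h
  rw [h]
  refine Nat.card_congr (Equiv.subtypeEquivRight fun τ => ?_)
  rw [doubleGenus₂_insert_join]
  exact and_iff_right (linked_insert_join _ _ _)

theorem sum_card_join (a c : ℕ) (w : ℤ) :
    ∑ r : Fin c, Nat.card {τ : Pairing (Fin (a + 1) ⊕ Fin c) //
      τ.1 (Sum.inl 0) = Sum.inr r ∧ Linked τ ∧ doubleGenus₂ τ = w} =
    c * count₁ (a + c - 1) w := by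
  obtain _ | b := c
  · simp
  · simp [card_join]

theorem count₂_zero (c : ℕ) (w : ℤ) : count₂ 0 c w = 0 := by
  refine @Nat.card_of_isEmpty _ ⟨?_⟩
  rintro ⟨τ, ⟨x, -⟩, -⟩
  exact x.elim0

theorem count₂_one (c : ℕ) (w : ℤ) : count₂ 1 c w = c * count₁ (c - 1) w := by
  rw [show c - 1 = 0 + c - 1 by omega]
  refine Eq.trans ?_ (sum_card_join 0 c w)
  rw [count₂, card_eq_sum_fiber (fun τ => τ.1 (Sum.inl 0)), Fintype.sum_sum_type]
  refine Nat.add_eq_right.2 (sum_eq_zero fun y _ => @Nat.card_of_isEmpty _ ⟨?_⟩)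
  rintro ⟨τ, hy, -⟩
  exact τ.2.2 _ (hy.trans (congrArg Sum.inl (Subsingleton.elim _ _)))

/-- The marked edge of the first polygon is glued to another edge of this polygon, which is then cut
in two, or to an edge of the second polygon (the last summand). In the first case the three polygons
are glued to a connected surface, or one of the two parts forms a component of its own. -/
theorem count₂_add_two (s c G : ℕ) :
    count₂ (s + 2) c (2 * (G : ℤ)) = ∑ p ∈ antidiagonal s,
      (count₃ p.1 p.2 c (2 * (G : ℤ) - 2) +
      ∑ h ∈ range (G + 1), count₁ p.2 (2 * (h : ℤ)) * count₂ p.1 c (2 * ((G - h : ℕ) : ℤ)) +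
      ∑ h ∈ range (G + 1), count₁ p.1 (2 * (h : ℤ)) * count₂ p.2 c (2 * ((G - h : ℕ) : ℤ))) +
      c * count₁ (s + c) (2 * (G : ℤ)) := by
  rw [count₂, card_eq_split_add (R := Fin c)
    (fun τ => Linked τ ∧ doubleGenus₂ τ = 2 * (G : ℤ)) s, sum_card_join (s + 1) c]
  congr 1
  · refine sum_congr rfl fun p _ => ?_
    rw [← card_linked_eq]
    refine Nat.card_congr (Equiv.subtypeEquivRight fun τ => ?_)
    rw [linked_insert, doubleGenus₂_insert, eq_sub_iff_add_eq]
  · rw [show s + 1 + c - 1 = s + c by omega]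

/-! ### The numbers of gluings as numbers of pairings -/

/-- Gluings are pairings of the edges. -/
def gluingEquiv {k : ℕ} (m : Fin k → ℕ) : Pairing (Edge m) ≃ Gluing m where
  toFun τ := ⟨τ.1, τ.2.1, τ.2.2⟩
  invFun G := ⟨G.opp, G.opp_opp, G.opp_ne⟩
  left_inv _ := rfl
  right_inv _ := rfl

/-- The numbers of gluings, for the edges labelled by another type `E`. -/
theorem epsTuple_eq {k : ℕ} {m : Fin k → ℕ} {E : Type} (β : E ≃ Edge m) (σ : Perm E)
    (hσ : ∀ x, β (σ x) = next m (β x)) (P : Pairing E → Prop)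
    (hP : ∀ τ, P τ ↔ (gluingEquiv m (Pairing.congr β τ)).IsConnected) (g : ℕ) :
    epsTuple g m = Nat.card {τ : Pairing E // P τ ∧ defect σ τ = 2 * (g : ℤ) + (k : ℤ) - 2} := by
  symm
  refine Nat.card_congr (((Pairing.congr β).trans (gluingEquiv m)).subtypeEquiv fun τ => ?_)
  refine and_congr (hP τ) ?_
  have h : (gluingEquiv m (Pairing.congr β τ)).eulerChar = -defect σ τ + (k : ℤ) := by
    rw [← defect_congr β hσ τ]
    change (numCycles (next m * (Pairing.congr β τ).1) : ℤ) - (numCycles (Pairing.congr β τ).1 : ℤ)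
      + (k : ℤ) = _
    unfold defect
    ring
  change _ ↔ (gluingEquiv m (Pairing.congr β τ)).eulerChar = _
  rw [h]
  constructor <;> intro h <;> linarith

theorem isConnected_iff {k : ℕ} [NeZero k] {m : Fin k → ℕ} (G : Gluing m) :
    G.IsConnected ↔ ∀ i j : Fin k, (Quot.mk _ i : G.Components) = Quot.mk _ j := by
  unfold Gluing.IsConnected
  rw [Nat.card_eq_one_iff_unique]
  constructor
  · rintro ⟨h, -⟩ i j
    exact @Subsingleton.elim _ h _ _
  · refine fun h => ⟨⟨fun x y => ?_⟩, ⟨Quot.mk _ 0⟩⟩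
    induction x using Quot.ind
    induction y using Quot.ind
    exact h _ _

/-- A connected gluing links every set of polygons to its complement. -/
theorem exists_link {k : ℕ} [NeZero k] {m : Fin k → ℕ} {G : Gluing m} (hG : G.IsConnected)
    (s : Fin k → Prop) {i j : Fin k} (hi : s i) (hj : ¬ s j) :
    ∃ e : Edge m, s e.1 ∧ ¬ s (G.opp e).1 := by
  by_contra! h
  have h' : ∀ i j : Fin k, (∃ e : Edge m, e.1 = i ∧ (G.opp e).1 = j) → s i = s j := by
    rintro _ _ ⟨e, rfl, rfl⟩
    refine propext ⟨h e, fun he => ?_⟩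
    have := h _ he
    rwa [G.opp_opp] at this
  have : s i = s j := congrArg (Quot.lift s h') ((isConnected_iff G).1 hG i j)
  exact hj (this ▸ hi)

/-- The edges of one polygon. -/
noncomputable def edgeEquiv₁ (m : Fin 1 → ℕ) : Fin (m 0) ≃ Edge m :=
  Equiv.ofBijective (fun x => ⟨0, x⟩) <| by
    constructor
    · intro x y h
      simpa using h
    · rintro ⟨i, x⟩
      obtain rfl := Subsingleton.elim 0 i
      exact ⟨x, rfl⟩

/-- The edges of two polygons. -/
noncomputable def edgeEquiv₂ (m : Fin 2 → ℕ) : Fin (m 0) ⊕ Fin (m 1) ≃ Edge m :=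
  Equiv.ofBijective (Sum.elim (fun x => ⟨0, x⟩) fun x => ⟨1, x⟩) <| by
    constructor
    · rintro (x | x) (y | y) h <;> simp at h ⊢ <;> exact h
    · rintro ⟨i, x⟩
      match i, x with
      | 0, x => exact ⟨Sum.inl x, rfl⟩
      | 1, x => exact ⟨Sum.inr x, rfl⟩

/-- The edges of three polygons. -/
noncomputable def edgeEquiv₃ (m : Fin 3 → ℕ) : (Fin (m 0) ⊕ Fin (m 1)) ⊕ Fin (m 2) ≃ Edge m :=
  Equiv.ofBijective
    (Sum.elim (Sum.elim (fun x => ⟨0, x⟩) fun x => ⟨1, x⟩) fun x => ⟨2, x⟩) <| by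
    constructor
    · rintro ((x | x) | x) ((y | y) | y) h <;> simp at h ⊢ <;> exact h
    · rintro ⟨i, x⟩
      match i, x with
      | 0, x => exact ⟨Sum.inl (Sum.inl x), rfl⟩
      | 1, x => exact ⟨Sum.inl (Sum.inr x), rfl⟩
      | 2, x => exact ⟨Sum.inr x, rfl⟩

theorem isConnected_one {m : Fin 1 → ℕ} (G : Gluing m) : G.IsConnected :=
  (isConnected_iff G).2 fun i j => by rw [Subsingleton.elim i j]

theorem linked_iff_isConnected {m : Fin 2 → ℕ} (τ : Pairing (Fin (m 0) ⊕ Fin (m 1))) :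
    Linked τ ↔ (gluingEquiv m (Pairing.congr (edgeEquiv₂ m) τ)).IsConnected := by
  constructor
  · rintro ⟨x, y, h⟩
    have h01 : (Quot.mk _ 0 : (gluingEquiv m (Pairing.congr (edgeEquiv₂ m) τ)).Components) =
        Quot.mk _ 1 := by
      refine Quot.sound ⟨edgeEquiv₂ m (Sum.inl x), rfl, ?_⟩
      change ((Pairing.congr (edgeEquiv₂ m) τ).1 _).1 = _
      rw [Pairing.congr_apply, h]
      rfl
    rw [isConnected_iff]
    intro i j
    fin_cases i <;> fin_cases j <;> first | rfl | exact h01 | exact h01.symm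
  · intro h
    obtain ⟨e, he, he'⟩ := exists_link h (fun i => i = 0) (i := 0) (j := 1) rfl (by simp)
    obtain ⟨x, rfl⟩ := (edgeEquiv₂ m).surjective e
    change ¬ ((Pairing.congr (edgeEquiv₂ m) τ).1 _).1 = _ at he'
    rw [Pairing.congr_apply] at he'
    obtain x | x := x
    · cases hx : τ.1 (Sum.inl x) with
      | inl y => rw [hx] at he'; exact absurd rfl he'
      | inr y => exact ⟨x, y, hx⟩
    · exact absurd (show (1 : Fin 2) = 0 from he) (by simp)

theorem connected₃_iff_isConnected {m : Fin 3 → ℕ}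
    (τ : Pairing ((Fin (m 0) ⊕ Fin (m 1)) ⊕ Fin (m 2))) :
    Connected₃ τ ↔ (gluingEquiv m (Pairing.congr (edgeEquiv₃ m) τ)).IsConnected := by
  have key : ∀ x y, τ.1 x = y →
      (Quot.mk _ (edgeEquiv₃ m x).1 :
        (gluingEquiv m (Pairing.congr (edgeEquiv₃ m) τ)).Components) =
      Quot.mk _ (edgeEquiv₃ m y).1 := by
    rintro x _ rfl
    refine Quot.sound ⟨edgeEquiv₃ m x, rfl, ?_⟩
    change ((Pairing.congr (edgeEquiv₃ m) τ).1 _).1 = _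
    rw [Pairing.congr_apply]
  have h12 : Linked₁₂ τ →
      (Quot.mk _ 0 : (gluingEquiv m (Pairing.congr (edgeEquiv₃ m) τ)).Components) =
        Quot.mk _ 1 := fun ⟨x, y, h⟩ => key _ _ h
  have h13 : Linked₁₃ τ →
      (Quot.mk _ 0 : (gluingEquiv m (Pairing.congr (edgeEquiv₃ m) τ)).Components) =
        Quot.mk _ 2 := fun ⟨x, y, h⟩ => key _ _ h
  have h23 : Linked₂₃ τ →
      (Quot.mk _ 1 : (gluingEquiv m (Pairing.congr (edgeEquiv₃ m) τ)).Components) =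
        Quot.mk _ 2 := fun ⟨x, y, h⟩ => key _ _ h
  constructor
  · intro h
    have h' : ∃ q, ∀ i, (Quot.mk _ i : (gluingEquiv m (Pairing.congr (edgeEquiv₃ m) τ)).Components)
        = q := by
      rcases h with ⟨h, h'⟩ | ⟨h, h' | h'⟩
      · refine ⟨Quot.mk _ 2, fun i => ?_⟩
        fin_cases i <;> [exact h13 h; exact h23 h'; rfl]
      · refine ⟨Quot.mk _ 0, fun i => ?_⟩
        fin_cases i <;> [rfl; exact (h12 h).symm; exact (h13 h').symm]
      · refine ⟨Quot.mk _ 1, fun i => ?_⟩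
        fin_cases i <;> [exact h12 h; rfl; exact (h23 h').symm]
    obtain ⟨q, hq⟩ := h'
    rw [isConnected_iff]
    intro i j
    rw [hq, hq]
  · intro h
    have key' : ∀ i j : Fin 3, i ≠ j → ∃ x, (edgeEquiv₃ m x).1 = i ∧
        (edgeEquiv₃ m (τ.1 x)).1 ≠ i := fun i j hij => by
      obtain ⟨e, he, he'⟩ := exists_link h (fun l => l = i) (i := i) (j := j) rfl hij.symm
      obtain ⟨x, rfl⟩ := (edgeEquiv₃ m).surjective e
      change ¬ ((Pairing.congr (edgeEquiv₃ m) τ).1 _).1 = _ at he'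
      rw [Pairing.congr_apply] at he'
      exact ⟨x, he, he'⟩
    have l1 : Linked₁₂ τ ∨ Linked₁₃ τ := by
      obtain ⟨(x | x) | x, hx, hx'⟩ := key' 0 1 (by simp)
      · cases hy : τ.1 (Sum.inl (Sum.inl x)) with
        | inl y =>
          cases y with
          | inl y => rw [hy] at hx'; exact absurd rfl hx'
          | inr y => exact Or.inl ⟨x, y, hy⟩
        | inr y => exact Or.inr ⟨x, y, hy⟩
      · exact absurd (show (1 : Fin 3) = 0 from hx) (by simp)
      · exact absurd (show (2 : Fin 3) = 0 from hx) (by simp)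
    have l2 : Linked₁₂ τ ∨ Linked₂₃ τ := by
      obtain ⟨(x | x) | x, hx, hx'⟩ := key' 1 0 (by simp)
      · exact absurd (show (0 : Fin 3) = 1 from hx) (by simp)
      · cases hy : τ.1 (Sum.inl (Sum.inr x)) with
        | inl y =>
          cases y with
          | inl y => exact Or.inl ⟨y, x, by rw [← hy, τ.2.1]⟩
          | inr y => rw [hy] at hx'; exact absurd rfl hx'
        | inr y => exact Or.inr ⟨x, y, hy⟩
      · exact absurd (show (2 : Fin 3) = 1 from hx) (by decide)
    have l3 : Linked₁₃ τ ∨ Linked₂₃ τ := by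
      obtain ⟨(x | x) | x, hx, hx'⟩ := key' 2 0 (by simp)
      · exact absurd (show (0 : Fin 3) = 2 from hx) (by simp)
      · exact absurd (show (1 : Fin 3) = 2 from hx) (by decide)
      · cases hy : τ.1 (Sum.inr x) with
        | inl y =>
          cases y with
          | inl y => exact Or.inl ⟨y, x, by rw [← hy, τ.2.1]⟩
          | inr y => exact Or.inr ⟨y, x, by rw [← hy, τ.2.1]⟩
        | inr y => rw [hy] at hx'; exact absurd rfl hx'
    unfold Connected₃
    tauto

theorem epsTuple_one {m : Fin 1 → ℕ} (h : ∀ i, 1 ≤ m i) (g : ℕ) :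
    epsTuple g m = count₁ (m 0) (2 * (g : ℤ)) := by
  rw [epsTuple_eq (edgeEquiv₁ m) (finRotate (m 0)) (fun _ => rfl) (fun _ => True)
    fun τ => iff_of_true trivial (isConnected_one _)]
  refine Nat.card_congr (Equiv.subtypeEquivRight fun τ => ?_)
  rw [doubleGenus₁, extraVertex, if_neg (by have := h 0; omega)]
  push_cast
  constructor
  · rintro ⟨-, h⟩
    linarith
  · exact fun h => ⟨trivial, by linarith⟩

theorem epsTuple_two {m : Fin 2 → ℕ} (h : ∀ i, 1 ≤ m i) (g : ℕ) :
    epsTuple g m = count₂ (m 0) (m 1) (2 * (g : ℤ)) := by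
  rw [epsTuple_eq (edgeEquiv₂ m) (Equiv.sumCongr (finRotate (m 0)) (finRotate (m 1)))
    (by rintro (x | x) <;> rfl) Linked linked_iff_isConnected]
  refine Nat.card_congr (Equiv.subtypeEquivRight fun τ => and_congr_right fun _ => ?_)
  rw [doubleGenus₂, extraVertex, extraVertex, if_neg (by have := h 0; omega),
    if_neg (by have := h 1; omega)]
  push_cast
  constructor <;> intro h <;> linarith

theorem epsTuple_three {m : Fin 3 → ℕ} (h : ∀ i, 1 ≤ m i) (g : ℕ) :
    epsTuple g m = count₃ (m 0) (m 1) (m 2) (2 * (g : ℤ)) := by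
  rw [epsTuple_eq (edgeEquiv₃ m)
    (Equiv.sumCongr (Equiv.sumCongr (finRotate (m 0)) (finRotate (m 1))) (finRotate (m 2)))
    (by rintro ((x | x) | x) <;> rfl) Connected₃ connected₃_iff_isConnected]
  refine Nat.card_congr (Equiv.subtypeEquivRight fun τ => and_congr_right fun _ => ?_)
  rw [doubleGenus₃, extraVertex, extraVertex, extraVertex, if_neg (by have := h 0; omega),
    if_neg (by have := h 1; omega), if_neg (by have := h 2; omega)]
  push_cast
  constructor <;> intro h <;> linarith

theorem count₂_eq_zero {a b : ℕ} (h : ¬ (1 ≤ a ∧ 1 ≤ b)) (w : ℤ) : count₂ a b w = 0 := by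
  refine @Nat.card_of_isEmpty _ ⟨?_⟩
  rintro ⟨τ, ⟨x, y, -⟩, -⟩
  exact h ⟨x.pos, y.pos⟩

theorem count₃_eq_zero {a b c : ℕ} (h : ¬ (1 ≤ a ∧ 1 ≤ b ∧ 1 ≤ c)) (w : ℤ) :
    count₃ a b c w = 0 := by
  refine @Nat.card_of_isEmpty _ ⟨?_⟩
  rintro ⟨τ, ⟨⟨x, y, -⟩, z, -, -⟩ | ⟨⟨x, y, -⟩, ⟨-, z, -⟩ | ⟨-, z, -⟩⟩, -⟩
  · exact h ⟨x.pos, z.pos, y.pos⟩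
  · exact h ⟨x.pos, y.pos, z.pos⟩
  · exact h ⟨x.pos, y.pos, z.pos⟩

theorem eps_one (g n : ℕ) : eps g n 1 = count₁ (2 * n) (2 * (g : ℤ)) := by
  unfold eps
  split_ifs with h0 hg
  · obtain ⟨rfl, -⟩ := hg
    subst h0
    refine ((Nat.card_eq_one_iff_unique).2 ⟨⟨fun x y => ?_⟩, ⟨⟨⟨1, ?_, ?_⟩, ?_⟩⟩⟩).symm
    · exact Subtype.ext (Subtype.ext (Equiv.ext fun i => i.elim0))
    · exact fun i => i.elim0
    · exact fun i => i.elim0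
    · simp [doubleGenus₁, defect_of_isEmpty, extraVertex]
  · subst h0
    refine (@Nat.card_of_isEmpty _ ⟨?_⟩).symm
    rintro ⟨τ, hτ⟩
    have : doubleGenus₁ (a := 2 * 0) τ = 0 := by
      simp [doubleGenus₁, defect_of_isEmpty, extraVertex]
    omega
  · rw [Nat.antidiagonalTuple_one, filter_true_of_mem, sum_singleton, epsTuple_one]
    · simp
    · intro i
      simp
      omega
    · intro m hm i
      rw [mem_singleton.1 hm]
      simp
      omega

/-- The sum may include polygons without edges, as they are in no connected gluing of two polygons. -/
theorem eps_two (g n : ℕ) :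
    eps g n 2 = ∑ p ∈ antidiagonal (2 * n), count₂ p.1 p.2 (2 * (g : ℤ)) := by
  unfold eps
  split_ifs with h0 hg
  · simp at hg
  · subst h0
    simp [count₂_zero]
  · rw [sum_filter, Nat.antidiagonalTuple_two, sum_map]
    refine sum_congr rfl fun p _ => ?_
    split_ifs with hp
    · exact epsTuple_two hp g
    · refine (count₂_eq_zero (fun h => hp ?_) _).symm
      rw [Fin.forall_fin_two]
      exact h

theorem eps_three {n : ℕ} (hn : 0 < n) (g : ℕ) :
    eps g n 3 = ∑ p ∈ antidiagonal (2 * n), ∑ q ∈ antidiagonal p.1,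
      count₃ q.1 q.2 p.2 (2 * (g : ℤ)) := by
  unfold eps
  rw [if_neg hn.ne', sum_filter, sum_sigma']
  refine sum_nbij' (fun m => ⟨(m 0 + m 1, m 2), (m 0, m 1)⟩) (fun x => ![x.2.1, x.2.2, x.1.2])
    ?_ ?_ ?_ ?_ ?_
  · intro m hm
    rw [Nat.mem_antidiagonalTuple, Fin.sum_univ_three] at hm
    simpa using hm
  · rintro ⟨⟨s, c⟩, ⟨a, b⟩⟩ h
    simp only [mem_sigma, HasAntidiagonal.mem_antidiagonal] at h
    simp [Nat.mem_antidiagonalTuple, Fin.sum_univ_three, h.1, h.2]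
  · intro m _
    ext i
    fin_cases i <;> rfl
  · rintro ⟨⟨s, c⟩, ⟨a, b⟩⟩ h
    simp only [mem_sigma, HasAntidiagonal.mem_antidiagonal] at h
    obtain ⟨-, rfl⟩ := h
    rfl
  · intro m _
    split_ifs with hp
    · exact epsTuple_three hp g
    · refine (count₃_eq_zero (fun h => hp ?_) _).symm
      intro i
      fin_cases i <;> [exact h.1; exact h.2.1; exact h.2.2]

/-! ### Summation -/

theorem count₁_of_odd {a : ℕ} (ha : ¬ 2 ∣ a) (w : ℤ) : count₁ a w = 0 := by
  refine @Nat.card_of_isEmpty _ ⟨?_⟩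
  rintro ⟨τ, -⟩
  have h1 : τ.1 ^ 2 = 1 := Equiv.ext fun x => by rw [pow_two]; exact τ.2.1 x
  have h2 := Perm.two_dvd_card_support h1
  have h3 : τ.1.support = univ := by
    ext x
    simpa using τ.2.2 x
  rw [h3, card_univ, Fintype.card_fin] at h2
  exact ha h2

/-- A polygon with an odd number of edges has no gluing by itself, so that only even summands matter. -/
theorem sum_antidiagonal_two_mul (F : ℕ → ℕ → ℕ) (hF : ∀ a b, ¬ 2 ∣ a → F a b = 0) (n : ℕ) :
    ∑ p ∈ antidiagonal (2 * n), F p.1 p.2 = ∑ i ∈ range (n + 1), F (2 * i) (2 * (n - i)) := by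
  have key : ∀ (f : ℕ → ℕ), (∀ a, ¬ 2 ∣ a → f a = 0) →
      ∀ n, ∑ k ∈ range (2 * n + 1), f k = ∑ i ∈ range (n + 1), f (2 * i) := fun f hf n => by
    induction n with
    | zero => simp
    | succ n ih =>
      rw [sum_range_succ _ (n + 1), ← ih, mul_add, mul_one, sum_range_succ, sum_range_succ,
        hf (2 * n + 1) (by omega), add_zero]
  rw [Nat.sum_antidiagonal_eq_sum_range_succ F, Nat.succ_eq_add_one,
    key (fun k => F k (2 * n - k)) (fun a ha => hF a _ ha)]
  exact sum_congr rfl fun i _ => by rw [Nat.mul_sub]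

theorem sum_antidiagonal_fst_comm (X : ℕ → ℕ → ℕ → ℕ) (N : ℕ) :
    ∑ p ∈ antidiagonal N, ∑ q ∈ antidiagonal p.1, X q.1 q.2 p.2 =
      ∑ p ∈ antidiagonal N, ∑ q ∈ antidiagonal p.2, X q.1 p.1 q.2 := by
  rw [sum_sigma', sum_sigma']
  refine sum_nbij' (fun x => ⟨(x.2.2, x.2.1 + x.1.2), (x.2.1, x.1.2)⟩)
    (fun x => ⟨(x.2.1 + x.1.1, x.2.2), (x.2.1, x.1.1)⟩) ?_ ?_ ?_ ?_ ?_
  · rintro ⟨⟨s, c⟩, ⟨a, b⟩⟩ h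
    simp only [mem_sigma, HasAntidiagonal.mem_antidiagonal, and_true] at h ⊢
    omega
  · rintro ⟨⟨s, c⟩, ⟨a, b⟩⟩ h
    simp only [mem_sigma, HasAntidiagonal.mem_antidiagonal, and_true] at h ⊢
    omega
  · rintro ⟨⟨s, c⟩, ⟨a, b⟩⟩ h
    simp only [mem_sigma, HasAntidiagonal.mem_antidiagonal] at h
    obtain ⟨-, rfl⟩ := h
    rfl
  · rintro ⟨⟨s, c⟩, ⟨a, b⟩⟩ h
    simp only [mem_sigma, HasAntidiagonal.mem_antidiagonal] at h
    obtain ⟨-, rfl⟩ := h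
    rfl
  · rintro ⟨⟨s, c⟩, ⟨a, b⟩⟩ h
    rfl

/-- The recursion for two polygons, summed over their sizes. The factor `∑ c` counts the choices of
the size of the second polygon together with the edge of it that the marked edge of the first is
glued to. -/
theorem sum_count₂ (N G : ℕ) :
    ∑ p ∈ antidiagonal (N + 2), count₂ p.1 p.2 (2 * (G : ℤ)) =
      ∑ p ∈ antidiagonal N, ∑ q ∈ antidiagonal p.1, count₃ q.1 q.2 p.2 (2 * (G : ℤ) - 2) +
      2 * ∑ p ∈ antidiagonal N, ∑ h ∈ range (G + 1), count₁ p.1 (2 * (h : ℤ)) *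
        ∑ q ∈ antidiagonal p.2, count₂ q.1 q.2 (2 * ((G - h : ℕ) : ℤ)) +
      (∑ c ∈ range (N + 2), c) * count₁ N (2 * (G : ℤ)) := by
  set X : ℕ → ℕ → ℕ → ℕ := fun a b c => ∑ h ∈ range (G + 1),
    count₁ b (2 * (h : ℤ)) * count₂ a c (2 * ((G - h : ℕ) : ℤ)) with hX
  have hX1 : ∑ p ∈ antidiagonal N, ∑ q ∈ antidiagonal p.1, X q.1 q.2 p.2 =
      ∑ p ∈ antidiagonal N, ∑ h ∈ range (G + 1), count₁ p.1 (2 * (h : ℤ)) *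
        ∑ q ∈ antidiagonal p.2, count₂ q.1 q.2 (2 * ((G - h : ℕ) : ℤ)) := by
    rw [sum_antidiagonal_fst_comm]
    refine sum_congr rfl fun p _ => ?_
    rw [hX, sum_comm]
    exact sum_congr rfl fun h _ => (mul_sum _ _ _).symm
  have hX2 : ∑ p ∈ antidiagonal N, ∑ q ∈ antidiagonal p.1, X q.2 q.1 p.2 =
      ∑ p ∈ antidiagonal N, ∑ q ∈ antidiagonal p.1, X q.1 q.2 p.2 :=
    sum_congr rfl fun p _ => Nat.sum_antidiagonal_swap (f := fun q => X q.1 q.2 p.2)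
  have hc : ∑ p ∈ antidiagonal N, p.2 * count₁ (p.1 + p.2) (2 * (G : ℤ)) =
      (∑ c ∈ range (N + 1), c) * count₁ N (2 * (G : ℤ)) := by
    rw [sum_mul, ← Nat.succ_eq_add_one,
      ← Nat.sum_antidiagonal_eq_sum_range_succ_mk (fun p => p.1 * count₁ N (2 * (G : ℤ))),
      ← Nat.sum_antidiagonal_swap]
    refine sum_congr rfl fun p hp => ?_
    rw [← HasAntidiagonal.mem_antidiagonal.1 hp, add_comm]
    rfl
  rw [Nat.sum_antidiagonal_succ, Nat.sum_antidiagonal_succ, count₂_zero, zero_add]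
  dsimp only
  rw [zero_add, count₂_one, sum_congr rfl fun p _ => count₂_add_two p.1 p.2 G]
  simp only [sum_add_distrib]
  rw [hc, sum_range_succ _ (N + 1), add_mul, ← hX1]
  change _ + (_ + ∑ p ∈ antidiagonal N, ∑ q ∈ antidiagonal p.1, X q.1 q.2 p.2 +
    ∑ p ∈ antidiagonal N, ∑ q ∈ antidiagonal p.1, X q.2 q.1 p.2 + _) = _
  rw [hX2, Nat.add_sub_cancel]
  ring

/-- The recursion for two polygons, solved for the number of gluings of one polygon. -/
theorem eps_succ_one (g n : ℕ) :
    eps (g + 1) (n + 1) 1 = eps g n 2 + ∑ h ∈ range (g + 2), ∑ i ∈ range (n + 1),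
      eps h i 1 * eps (g + 1 - h) (n - i) 1 := by
  have h := count₁_add_two (2 * n) (g + 1)
  rw [show 2 * ((g + 1 : ℕ) : ℤ) - 2 = 2 * (g : ℤ) by push_cast; ring, sum_add_distrib,
    ← eps_two, sum_antidiagonal_two_mul (fun a b => ∑ h ∈ range (g + 1 + 1),
      count₁ a (2 * (h : ℤ)) * count₁ b (2 * ((g + 1 - h : ℕ) : ℤ)))
    (fun a b ha => sum_eq_zero fun h _ => by rw [count₁_of_odd ha, zero_mul]), sum_comm] at h
  simp only [← eps_one] at h
  rwa [show 2 * n + 2 = 2 * (n + 1) by ring, ← eps_one] at h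

/-- The recursion for three polygons, solved for the number of gluings of two polygons. -/
theorem eps_succ_two (g : ℕ) {n : ℕ} (hn : 0 < n) :
    eps (g + 1) (n + 1) 2 = eps g n 3 + 2 * ∑ h ∈ range (g + 2), ∑ i ∈ range (n + 1),
      eps h i 1 * eps (g + 1 - h) (n - i) 2 + (n + 1) * (2 * n + 1) * eps (g + 1) n 1 := by
  have h := sum_count₂ (2 * n) (g + 1)
  rw [show 2 * ((g + 1 : ℕ) : ℤ) - 2 = 2 * (g : ℤ) by push_cast; ring, ← eps_three hn,
    sum_antidiagonal_two_mul (fun a b => ∑ h ∈ range (g + 1 + 1), count₁ a (2 * (h : ℤ)) *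
      ∑ q ∈ HasAntidiagonal.antidiagonal b, count₂ q.1 q.2 (2 * ((g + 1 - h : ℕ) : ℤ)))
    (fun a b ha => sum_eq_zero fun h _ => by rw [count₁_of_odd ha, zero_mul]), sum_comm] at h
  simp only [← eps_one, ← eps_two] at h
  rw [show 2 * n + 2 = 2 * (n + 1) by ring, ← eps_two] at h
  have hs : ∑ c ∈ range (2 * (n + 1)), c = (n + 1) * (2 * n + 1) := by
    rw [sum_range_id, mul_assoc, Nat.mul_div_cancel_left _ two_pos]
    rfl
  rw [h, hs]

end PolygonGluing

theorem corollary1 (g n : ℕ) (hn : 0 < n) :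
    (PolygonGluing.eps g n 2 : ℤ) =
        (PolygonGluing.eps (g + 1) (n + 1) 1 : ℤ)
          - ∑ h ∈ Finset.range (g + 2), ∑ i ∈ Finset.range (n + 1),
              (PolygonGluing.eps h i 1 : ℤ) * (PolygonGluing.eps (g + 1 - h) (n - i) 1 : ℤ) ∧
      (PolygonGluing.eps g n 3 : ℤ) =
        (PolygonGluing.eps (g + 1) (n + 1) 2 : ℤ)
          - 2 * ∑ h ∈ Finset.range (g + 2), ∑ i ∈ Finset.range (n + 1),
              (PolygonGluing.eps h i 1 : ℤ) * (PolygonGluing.eps (g + 1 - h) (n - i) 2 : ℤ)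
          - ((n : ℤ) + 1) * (2 * (n : ℤ) + 1) * (PolygonGluing.eps (g + 1) n 1 : ℤ) := by
  constructor
  · rw [PolygonGluing.eps_succ_one]
    push_cast
    ring
  · rw [PolygonGluing.eps_succ_two g hn]
    push_cast
    ring
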